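/- **Setting.** Let $d\in\mathbb N$, let $\mathbf A\subset\mathbb Z^d$ be a finite set of actions, and let $\mathbf x,\mathbf y\in\mathbb N^d$. A transition is a triple $(\mathbf u,\mathbf a,\mathbf v)\in\mathbb N^d\times\mathbf A\times\mathbb N^d$ with $\mathbf v=\mathbf u+\mathbf a$. A prerun is a triple $(\mathbf u,w,\mathbf v)$ with $\mathbf u,\mathbf v\in\mathbb N^d$ and $w\in(\mathbb N^d\times\mathbf A\times\mathbb N^d)^*$; its label is the sequence of actions in $w$. It is a run if $w$ is a sequence of transitions forming a path from $\mathbf u$ to $\mathbf v$ (with $\mathbf u=\mathbf v$ if $w=\varepsilon$); we then write $\mathbf u\xrightarrow{\sigma}\mathbf v$, where $\sigma$ is its label. $\mathrm{Runs}(\mathbf x,\mathbf y)$ is the set of runs from $\mathbf x$ to $\mathbf y$. Order $\mathbb N^d\times\mathbf A\times\mathbb N^d$ by the product order ($\mathbf A$ being ordered by equality), words over it by the induced subword embedding, and preruns componentwise; $\downarrow$ of a set of preruns is taken among all preruns. An ideal is a non-empty, directed, downward-closed set; an ideal $I$ is in the adherence of a set $S$ if $I={\downarrow}\Delta$ for some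 directed $\Delta\subseteq S$. Let $\mathbb N_\omega=\mathbb N\cup\{\omega\}$, where $\omega$ is the top element and $\omega+z=\omega$ for $z\in\mathbb Z$. For $\mathbf u\in\mathbb N_\omega^d$ let ${\downarrow}\mathbf u=\{\mathbf c\in\mathbb N^d:\mathbf c\le\mathbf u\}$, and for a triple ${\downarrow}(\mathbf u,\mathbf a,\mathbf v)={\downarrow}\mathbf u\times\{\mathbf a\}\times{\downarrow}\mathbf v$; for a set $E$ of triples ${\downarrow}E=\bigcup_{e\in E}{\downarrow}e$. For $F\subseteq\{1,\dots,d\}$, $\pi_F$ replaces the coordinates outside $F$ by $\omega$. A partial transition is a triple $(\mathbf u,\mathbf a,\mathbf v)\in\mathbb N_\omega^d\times\mathbf A\times\mathbb N_\omega^d$ with $\mathbf v=\mathbf u+\mathbf a$; paths of partial transitions are also written $\mathbf u\xrightarrow{\sigma}\mathbf v$. A witness graph is a strongly connected graph $G=(\mathbf S,E,\mathbf s)$, where $\mathbf S\subseteq\mathbb N_\omega^d$ is finite, $\mathbf s\in\mathbf S$, all elements of $\mathbf S$ have the same set $F$ of finite coordinates, and $E\subseteq\mathbf S\times\mathbf A\times\mathbf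 S$ is a set of partial transitions. A marked witness graph is a triple $M=(\mathbf s^{\mathrm{in}},G,\mathbf s^{\mathrm{out}})$, where $\mathbf s^{\mathrm{in}},\mathbf s^{\mathrm{out}}\in\mathbb N_\omega^d$ have sets of finite coordinates $F^{\mathrm{in}},F^{\mathrm{out}}\supseteq F$ and $\pi_F(\mathbf s^{\mathrm{in}})=\pi_F(\mathbf s^{\mathrm{out}})=\mathbf s$. $\Omega_M$ is the set of runs $\mathbf u\xrightarrow{\sigma}\mathbf v$ such that $\sigma$ is the label of a (possibly empty) cycle on $\mathbf s$ in $G$, $\pi_{F^{\mathrm{in}}}(\mathbf u)=\mathbf s^{\mathrm{in}}$ and $\pi_{F^{\mathrm{out}}}(\mathbf v)=\mathbf s^{\mathrm{out}}$. An element $\mathbf u$ of $\mathbb N_\omega^d$ is forward pumpable by $G$ if there are a cycle on $\mathbf s$ with some label $\sigma$ and $\mathbf u'\ge\mathbf u$ with $\mathbf u\xrightarrow{\sigma}\mathbf u'$, such that ${\downarrow}\mathbf s=\bigcup_n{\downarrow}\mathbf u_n$, where $\mathbf u\xrightarrow{\sigma^n}\mathbf u_n$. It is backward pumpable by $G$ if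 there are a cycle on $\mathbf s$ with some label $\sigma$ and $\mathbf u'\ge\mathbf u$ with $\mathbf u'\xrightarrow{\sigma}\mathbf u$, such that ${\downarrow}\mathbf s=\bigcup_n{\downarrow}\mathbf u_n$, where $\mathbf u_n\xrightarrow{\sigma^n}\mathbf u$. A marked witness graph sequence is $\xi=M_0,\mathbf a_1,M_1,\dots,\mathbf a_k,M_k$ ($k\ge0$), where the $M_j=(\mathbf s_j^{\mathrm{in}},(\mathbf S_j,E_j,\mathbf s_j),\mathbf s_j^{\mathrm{out}})$ are marked witness graphs, $\mathbf a_j\in\mathbf A$, $\mathbf s_0^{\mathrm{in}}=\mathbf x$ and $\mathbf s_k^{\mathrm{out}}=\mathbf y$. Put $A_j={\downarrow}(\mathbf s_{j-1}^{\mathrm{out}},\mathbf a_j,\mathbf s_j^{\mathrm{in}})\cup\{\varepsilon\}$ and $$I_\xi={\downarrow}\mathbf x\times({\downarrow}E_0)^*A_1({\downarrow}E_1)^*\cdots A_k({\downarrow}E_k)^*\times{\downarrow}\mathbf y .$$ Let $\Omega_\xi$ be the set of runs of the form $\mathbf x_0\xrightarrow{\sigma_0}\mathbf y_0\xrightarrow{\mathbf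 a_1}\mathbf x_1\xrightarrow{\sigma_1}\mathbf y_1\cdots\xrightarrow{\mathbf a_k}\mathbf x_k\xrightarrow{\sigma_k}\mathbf y_k$ in which each $\mathbf x_j\xrightarrow{\sigma_j}\mathbf y_j$ is in $\Omega_{M_j}$. Let $L_\xi$ be the set of tuples $(\mathbf x_j,\psi_j,\mathbf y_j)_{0\le j\le k}$ with $\mathbf x_j,\mathbf y_j\in\mathbb N^d$ and $\psi_j:E_j\to\mathbb N$ such that, for all $j$: * for every $\mathbf s\in\mathbf S_j$, the sum of $\psi_j$ over the edges entering $\mathbf s$ equals its sum over the edges leaving $\mathbf s$; * $\mathbf y_j=\mathbf x_j+\sum_{e\in E_j}\psi_j(e)\Delta(e)$, where $\Delta(e)$ is the action of $e$; * $\mathbf x_j=\mathbf y_{j-1}+\mathbf a_j$ if $j\ge1$; * $\pi_{F_j^{\mathrm{in}}}(\mathbf x_j)=\mathbf s_j^{\mathrm{in}}$ and $\pi_{F_j^{\mathrm{out}}}(\mathbf y_j)=\mathbf s_j^{\mathrm{out}}$. The sequence $\xi$ is perfect if $L_\xi\ne\emptyset$ and, for all $j$: $\mathbf s_j^{\mathrm{in}}$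 is forward pumpable and $\mathbf s_j^{\mathrm{out}}$ is backward pumpable by $G_j=(\mathbf S_j,E_j,\mathbf s_j)$; over all elements of $L_\xi$, $\sup\mathbf x_j=\mathbf s_j^{\mathrm{in}}$ and $\sup\mathbf y_j=\mathbf s_j^{\mathrm{out}}$ in $\mathbb N_\omega^d$; and $\sup\psi_j(e)=\omega$ for every $e\in E_j$. **Lemma.** If $\xi$ is a perfect marked witness graph sequence, then $I_\xi$ is in the adherence of $\mathrm{Runs}(\mathbf x,\mathbf y)$ (in particular $I_\xi$ is an ideal), and $I_\xi={\downarrow}\Omega_\xi$. -/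

import Mathlib

namespace VAS

/-- Configurations, i.e. vectors in `ℕ^d`. -/
abbrev Conf (d : ℕ) : Type := Fin d → ℕ

/-- Partial configurations, i.e. vectors in `(ℕ ∪ {ω})^d`, where `ω` is `⊤`. -/
abbrev PConf (d : ℕ) : Type := Fin d → ℕ∞

/-- Triples in `V × A × V`, where `A` is a finite set of actions in `ℤ^d`. -/
structure Triple {d : ℕ} (V : Type) (A : Finset (Fin d → ℤ)) where
  src : V
  act : A
  tgt : V

/-- The product ordering on `V × A × V`, where the finite set `A` is ordered by equality. -/
instance {d : ℕ} {V : Type} [Preorder V] {A : Finset (Fin d → ℤ)} : Preorder (Triple V A) where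
  le t t' := t.src ≤ t'.src ∧ t.act = t'.act ∧ t.tgt ≤ t'.tgt
  le_refl t := ⟨le_refl _, rfl, le_refl _⟩
  le_trans _ _ _ h h' := ⟨h.1.trans h'.1, h.2.1.trans h'.2.1, h.2.2.trans h'.2.2⟩

/-- `IsPath u w v`: either `w` is empty and `u = v`, or `w` starts in `u`, ends in `v`, and
each triple of `w` starts where the previous one ends. -/
def IsPath {d : ℕ} {V : Type} {A : Finset (Fin d → ℤ)} : V → List (Triple V A) → V → Prop
  | u, [], v => u = v
  | u, t :: w, v => t.src = u ∧ IsPath t.tgt w v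

/-- The action sequence of a sequence of triples. -/
def label {d : ℕ} {V : Type} {A : Finset (Fin d → ℤ)} (w : List (Triple V A)) : List A :=
  w.map Triple.act

/-! ### Preruns and runs -/

/-- Transitions: triples `(u, a, v)` in `ℕ^d × A × ℕ^d` with `v = u + a`. -/
def IsTransition {d : ℕ} {A : Finset (Fin d → ℤ)} (t : Triple (Conf d) A) : Prop :=
  ∀ i, (t.tgt i : ℤ) = (t.src i : ℤ) + t.act.1 i

/-- Preruns over `A`. -/
structure Prerun {d : ℕ} (A : Finset (Fin d → ℤ)) where
  src : Conf d
  word : List (Triple (Conf d) A)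
  tgt : Conf d

/-- The ordering of preruns: componentwise ordering of sources and of targets, and the
(subword) embedding ordering of the sequences of triples. -/
instance {d : ℕ} {A : Finset (Fin d → ℤ)} : Preorder (Prerun A) where
  le ρ ρ' := ρ.src ≤ ρ'.src ∧ List.SublistForall₂ (· ≤ ·) ρ.word ρ'.word ∧ ρ.tgt ≤ ρ'.tgt
  le_refl ρ := ⟨le_refl _, refl_of (List.SublistForall₂ (· ≤ ·)) ρ.word, le_refl _⟩
  le_trans _ _ _ h h' :=
    ⟨h.1.trans h'.1, trans_of (List.SublistForall₂ (· ≤ ·)) h.2.1 h'.2.1, h.2.2.trans h'.2.2⟩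

/-- Runs: preruns that are connected sequences of transitions. -/
def IsRun {d : ℕ} {A : Finset (Fin d → ℤ)} (ρ : Prerun A) : Prop :=
  (∀ t ∈ ρ.word, IsTransition t) ∧ IsPath ρ.src ρ.word ρ.tgt

/-- The set of runs of `A` from `x` to `y`. -/
def Runs {d : ℕ} (A : Finset (Fin d → ℤ)) (x y : Conf d) : Set (Prerun A) :=
  {ρ | IsRun ρ ∧ ρ.src = x ∧ ρ.tgt = y}

/-- `I` is in the adherence of `S`: `I` is an ideal, and it is the downward closure of a
directed subset of `S`. -/
def InAdherence {X : Type} [Preorder X] (S I : Set X) : Prop :=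
  Order.IsIdeal I ∧ ∃ Δ : Set X, Δ ⊆ S ∧ DirectedOn (· ≤ ·) Δ ∧ (lowerClosure Δ : Set X) = I

/-! ### Partial configurations and partial transitions -/

/-- A configuration seen as a partial configuration. -/
def emb {d : ℕ} (u : Conf d) : PConf d := fun i => (u i : ℕ∞)

/-- The set of configurations below a partial configuration. -/
def downConf {d : ℕ} (u : PConf d) : Set (Conf d) := {c | emb c ≤ u}

/-- The set of finite coordinates of a partial configuration. -/
def finCoords {d : ℕ} (u : PConf d) : Set (Fin d) := {i | u i ≠ ⊤}

open Classical in
/-- The projection on a set `F` of coordinates: the coordinates outside `F` become `ω`. -/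
noncomputable def proj {d : ℕ} (F : Set (Fin d)) (u : PConf d) : PConf d :=
  fun i => if i ∈ F then u i else ⊤

/-- Partial transitions: triples `(u, a, v)` of `ℕ_ω^d × A × ℕ_ω^d` with `v = u + a`, computed
in `ℤ ∪ {ω}`. -/
def IsPartialTransition {d : ℕ} {A : Finset (Fin d → ℤ)} (t : Triple (PConf d) A) : Prop :=
  ∀ i, ENat.map (fun n : ℕ => (n : ℤ)) (t.tgt i) =
    ENat.map (fun n : ℕ => (n : ℤ)) (t.src i) + ((t.act.1 i : ℤ) : WithTop ℤ)

/-- The set of triples of `ℕ^d × A × ℕ^d` below a triple of `ℕ_ω^d × A × ℕ_ω^d`. -/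
def downTriple {d : ℕ} {A : Finset (Fin d → ℤ)} (t : Triple (PConf d) A) :
    Set (Triple (Conf d) A) :=
  {c | c.src ∈ downConf t.src ∧ c.act = t.act ∧ c.tgt ∈ downConf t.tgt}

/-- There is a run of partial transitions from `u` to `v` labelled by `σ`. -/
def PRun {d : ℕ} {A : Finset (Fin d → ℤ)} (u : PConf d) (σ : List A) (v : PConf d) : Prop :=
  ∃ w : List (Triple (PConf d) A),
    (∀ t ∈ w, IsPartialTransition t) ∧ IsPath u w v ∧ label w = σ

/-! ### Witness graphs -/

/-- Witness graphs. All states have the same set of finite coordinates as `s`. -/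
structure WitnessGraph {d : ℕ} (A : Finset (Fin d → ℤ)) where
  S : Finset (PConf d)
  E : Finset (Triple (PConf d) A)
  s : PConf d
  s_mem : s ∈ S
  finCoords_eq : ∀ u ∈ S, finCoords u = finCoords s
  edges : ∀ e ∈ E, e.src ∈ S ∧ e.tgt ∈ S ∧ IsPartialTransition e
  stronglyConnected : ∀ u ∈ S, ∀ v ∈ S, ∃ w : List (Triple (PConf d) A),
    (∀ e ∈ w, e ∈ E) ∧ IsPath u w v

namespace WitnessGraph

variable {d : ℕ} {A : Finset (Fin d → ℤ)}

/-- The set `F` of finite coordinates of the states. -/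
def F (G : WitnessGraph A) : Set (Fin d) := finCoords G.s

/-- `σ` is the label of a (possibly empty) cycle on the distinguished state. -/
def IsCycleLabel (G : WitnessGraph A) (σ : List A) : Prop :=
  ∃ w : List (Triple (PConf d) A), (∀ e ∈ w, e ∈ G.E) ∧ IsPath G.s w G.s ∧ label w = σ

/-- `x` is forward pumpable by `G`. The partial configurations `xs n` are determined
by `x`, `σ` and `n`. -/
def ForwardPumpable (G : WitnessGraph A) (x : PConf d) : Prop :=
  ∃ σ : List A, G.IsCycleLabel σ ∧ (∃ x' : PConf d, PRun x σ x' ∧ x ≤ x') ∧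
    ∃ xs : ℕ → PConf d, (∀ n, PRun x (List.replicate n σ).flatten (xs n)) ∧
      downConf G.s = ⋃ n, downConf (xs n)

/-- `y` is backward pumpable by `G`. The partial configurations `ys n` are determined
by `y`, `σ` and `n`. -/
def BackwardPumpable (G : WitnessGraph A) (y : PConf d) : Prop :=
  ∃ σ : List A, G.IsCycleLabel σ ∧ (∃ y' : PConf d, PRun y' σ y ∧ y ≤ y') ∧
    ∃ ys : ℕ → PConf d, (∀ n, PRun (ys n) (List.replicate n σ).flatten y) ∧
      downConf G.s = ⋃ n, downConf (ys n)

end WitnessGraph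

/-- Marked witness graphs. -/
structure MarkedWitnessGraph {d : ℕ} (A : Finset (Fin d → ℤ)) where
  sIn : PConf d
  G : WitnessGraph A
  sOut : PConf d
  F_subset_in : G.F ⊆ finCoords sIn
  F_subset_out : G.F ⊆ finCoords sOut
  proj_in : proj G.F sIn = G.s
  proj_out : proj G.F sOut = G.s

/-- The set `Ω_M` of runs of a marked witness graph. -/
def MarkedWitnessGraph.runs {d : ℕ} {A : Finset (Fin d → ℤ)} (M : MarkedWitnessGraph A) :
    Set (Prerun A) :=
  {ρ | IsRun ρ ∧ M.G.IsCycleLabel (label ρ.word) ∧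
    proj (finCoords M.sIn) (emb ρ.src) = M.sIn ∧ proj (finCoords M.sOut) (emb ρ.tgt) = M.sOut}

/-! ### Marked witness graph sequences -/

/-- Marked witness graph sequences `M 0, a 0, M 1, …, a (k - 1), M k` with input `x` and
output `y`. -/
structure MWGSeq {d : ℕ} (A : Finset (Fin d → ℤ)) (x y : Conf d) where
  k : ℕ
  M : Fin (k + 1) → MarkedWitnessGraph A
  a : Fin k → A
  first : (M 0).sIn = emb x
  last : (M (Fin.last k)).sOut = emb y

/-- The atom `D^*`. -/
def starAtom {α : Type} (D : Set α) : Language α := {w | ∀ t ∈ w, t ∈ D}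

/-- The atom `I ∪ {ε}`. -/
def optAtom {α : Type} (I : Set α) : Language α := {w | w = [] ∨ ∃ t ∈ I, w = [t]}

namespace MWGSeq

variable {d : ℕ} {A : Finset (Fin d → ℤ)} {x y : Conf d}

/-- The language `(↓E_j)^*`. -/
def graphAtom (ξ : MWGSeq A x y) (j : Fin (ξ.k + 1)) : Language (Triple (Conf d) A) :=
  starAtom (⋃ e ∈ (ξ.M j).G.E, downTriple e)

/-- The language `↓(s_j^out, a, s_{j+1}^in) ∪ {ε}`, where `a` is the action between the
`j`-th and the next marked witness graph. -/
def actionAtom (ξ : MWGSeq A x y) (j : Fin ξ.k) : Language (Triple (Conf d) A) :=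
  optAtom (downTriple ⟨(ξ.M j.castSucc).sOut, ξ.a j, (ξ.M j.succ).sIn⟩)

/-- The prerun ideal `I_ξ`. -/
def ideal (ξ : MWGSeq A x y) : Set (Prerun A) :=
  {ρ | ρ.src ≤ x ∧
    ρ.word ∈ ξ.graphAtom 0 *
      (List.ofFn fun j : Fin ξ.k => ξ.actionAtom j * ξ.graphAtom j.succ).prod ∧
    ρ.tgt ≤ y}

/-- The set `Ω_ξ` of runs that are obtained by joining runs `r j` of `Ω_{M_j}` by transitions
labelled by the actions of `ξ`. -/
def runs (ξ : MWGSeq A x y) : Set (Prerun A) :=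
  {ρ | ∃ r : Fin (ξ.k + 1) → Prerun A,
    (∀ j, r j ∈ (ξ.M j).runs) ∧
    (∀ j : Fin ξ.k, IsTransition ⟨(r j.castSucc).tgt, ξ.a j, (r j.succ).src⟩) ∧
    ρ.src = (r 0).src ∧
    ρ.word = (r 0).word ++ (List.ofFn fun j : Fin ξ.k =>
      (⟨(r j.castSucc).tgt, ξ.a j, (r j.succ).src⟩ : Triple (Conf d) A) ::
        (r j.succ).word).flatten ∧
    ρ.tgt = (r (Fin.last ξ.k)).tgt}

/-- The tuples `(x_0, ψ_0, y_0, …, x_k, ψ_k, y_k)`. -/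
abbrev Tuple (ξ : MWGSeq A x y) : Type :=
  ∀ j : Fin (ξ.k + 1), Conf d × ((ξ.M j).G.E → ℕ) × Conf d

/-- The set `L_ξ` of solutions of the linear system associated with `ξ`. -/
def L (ξ : MWGSeq A x y) : Set ξ.Tuple :=
  {z | (∀ j, ∀ s ∈ (ξ.M j).G.S,
      (∑ e : (ξ.M j).G.E with e.1.tgt = s, (z j).2.1 e) =
        ∑ e : (ξ.M j).G.E with e.1.src = s, (z j).2.1 e) ∧
    (∀ j, ∀ i, ((z j).2.2 i : ℤ) =
      (z j).1 i + ∑ e : (ξ.M j).G.E, ((z j).2.1 e : ℤ) * e.1.act.1 i) ∧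
    (∀ j : Fin ξ.k, IsTransition ⟨(z j.castSucc).2.2, ξ.a j, (z j.succ).1⟩) ∧
    (∀ j, proj (finCoords (ξ.M j).sIn) (emb (z j).1) = (ξ.M j).sIn ∧
      proj (finCoords (ξ.M j).sOut) (emb (z j).2.2) = (ξ.M j).sOut)}

/-- Perfectness. The suprema are those of non-empty sets of solutions. -/
def Perfect (ξ : MWGSeq A x y) : Prop :=
  ξ.L.Nonempty ∧
  ∀ j, (ξ.M j).G.ForwardPumpable (ξ.M j).sIn ∧
    (ξ.M j).G.BackwardPumpable (ξ.M j).sOut ∧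
    (⨆ z ∈ ξ.L, emb (z j).1) = (ξ.M j).sIn ∧
    (⨆ z ∈ ξ.L, emb (z j).2.2) = (ξ.M j).sOut ∧
    ∀ e : (ξ.M j).G.E, (⨆ z ∈ ξ.L, ((z j).2.1 e : ℕ∞)) = ⊤

end MWGSeq

end VAS

/-! The set `ξ.ideal` is downward closed, directed, and contains `ξ.runs`, whose elements are runs
from `x` to `y`. Everything follows once `ξ.runs` is cofinal in `ξ.ideal` (`Perfect.exists_run_ge`):
a cofinal subset of a directed lower set is directed and has that set as its downward closure.

Linear part. If a component is unbounded on `ξ.L`, Dickson's lemma yields two comparable solutions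
that differ there; their difference solves the homogeneous system and is positive on that component.
Summing gives one homogeneous solution (x₁, φ₁, y₁) that is positive on every edge and every
ω-coordinate of the markings (`Perfect.exists_homSolution`). Fix also a solution (x₀, φ₀, y₀) in
`ξ.L`.

Runs in one witness graph. Let c and c' be forward and backward pumping cycles. For large m, the
circulations φ₀ + mφ₁ and mφ₁ minus the edge counts of c and c' are positive, hence are the edge
counts of cycles μ and θ (`exists_eulerian_cycle`). The cycle c^t μ θ^t c'^t leads from x₀ + (t+1)m
x₁ to y₀ + (t+1)m y₁. On coordinates that are ω in the states, its value is at least t after c^t, up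
to the bounded effect of μ, and stays of that order along θ^t, so for large t it is never negative
(`safe_pumping`); on the other coordinates all cycles have effect zero. As θ uses every edge, θ^t
dominates any given word over the down-closed edges for large t (`MarkedWitnessGraph.exists_runs`).

Gluing. With m and t common to all graphs, the endpoints are those of a single solution of the
linear system, so the actions of `ξ` join consecutive runs, and the endpoints are large enough to
cover the action triples. -/

namespace VAS

/-! ### Action sequences: effect, safety of one coordinate, lifting to runs -/

section Words

variable {d : ℕ} {A : Finset (Fin d → ℤ)}

/-- The effect of a sequence of actions on the coordinate `i`. -/
def eff (σ : List A) (i : Fin d) : ℤ := (σ.map fun a => a.1 i).sum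

@[simp] theorem eff_nil (i : Fin d) : eff ([] : List A) i = 0 := by simp [eff]

@[simp] theorem eff_cons (a : A) (σ : List A) (i : Fin d) :
    eff (a :: σ) i = a.1 i + eff σ i := by simp [eff]

@[simp] theorem eff_append (σ τ : List A) (i : Fin d) :
    eff (σ ++ τ) i = eff σ i + eff τ i := by simp [eff]

@[simp] theorem eff_replicate (n : ℕ) (σ : List A) (i : Fin d) :
    eff (List.replicate n σ).flatten i = n * eff σ i := by
  induction n with
  | zero => simp
  | succ n ih => simp [List.replicate_succ, ih]; ring

/-- The coordinate `i` stays at least `B` when the actions `σ` are applied from the value `u`. -/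
def Safe (i : Fin d) (B : ℤ) : ℤ → List A → Prop
  | u, [] => B ≤ u
  | u, a :: σ => B ≤ u ∧ Safe i B (u + a.1 i) σ

theorem Safe.start {i : Fin d} {B u : ℤ} {σ : List A} (h : Safe i B u σ) : B ≤ u := by
  cases σ with
  | nil => exact h
  | cons a σ => exact h.1

theorem safe_append {i : Fin d} {B u : ℤ} {σ τ : List A} :
    Safe i B u (σ ++ τ) ↔ Safe i B u σ ∧ Safe i B (u + eff σ i) τ := by
  induction σ generalizing u with
  | nil => simpa [Safe] using fun h : Safe i B u τ => h.start
  | cons a σ ih => simp [Safe, ih, and_assoc, add_assoc]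

theorem Safe.mono {i : Fin d} {B u u' : ℤ} {σ : List A} (h : Safe i B u σ) (hu : u ≤ u') :
    Safe i B u' σ := by
  induction σ generalizing u u' with
  | nil => exact le_trans h hu
  | cons a σ ih => exact ⟨h.1.trans hu, ih h.2 (by linarith)⟩

theorem Safe.mono_left {i : Fin d} {B B' u : ℤ} {σ : List A} (h : Safe i B u σ) (hB : B' ≤ B) :
    Safe i B' u σ := by
  induction σ generalizing u with
  | nil => exact hB.trans h
  | cons a σ ih => exact ⟨hB.trans h.1, ih h.2⟩

theorem Safe.finish {i : Fin d} {B u : ℤ} {σ : List A} (h : Safe i B u σ) :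
    B ≤ u + eff σ i := by
  have h' : Safe i B u (σ ++ []) := by simpa using h
  exact (safe_append.1 h').2.start

/-- Only the values at which the n copies begin matter, so the bound is required for k < n and not
for the final value. -/
theorem Safe.replicate {i : Fin d} {B u₀ u : ℤ} {σ : List A} (h : Safe i B u₀ σ) {n : ℕ}
    (hB : B ≤ u) (hu : ∀ k < n, u₀ ≤ u + k * eff σ i) :
    Safe i B u (List.replicate n σ).flatten := by
  induction n generalizing u with
  | zero => simpa [Safe] using hB
  | succ n ih =>
    rw [List.replicate_succ, List.flatten_cons, safe_append]
    have h0 : Safe i B u σ := h.mono (by simpa using hu 0 n.succ_pos)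
    refine ⟨h0, ih h0.finish fun k hk => ?_⟩
    have := hu (k + 1) (by omega)
    push_cast at this
    linarith

/-- The sum of the absolute values of the entries of all actions of `σ`. -/
def cost (σ : List A) : ℤ := (σ.map fun a => ∑ i, |a.1 i|).sum

theorem abs_eff_le_cost (σ : List A) (i : Fin d) : |eff σ i| ≤ cost σ := by
  induction σ with
  | nil => simp [cost]
  | cons a σ ih =>
    have h1 : |a.1 i| ≤ ∑ i, |a.1 i| :=
      Finset.single_le_sum (f := fun i => |a.1 i|) (fun _ _ => abs_nonneg _) (Finset.mem_univ i)
    have h2 := abs_add_le (a.1 i) (eff σ i)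
    simp only [cost, eff_cons, List.map_cons, List.sum_cons] at *
    linarith

theorem cost_nonneg (σ : List A) : 0 ≤ cost σ := by
  apply List.sum_nonneg
  simp only [List.mem_map]
  rintro _ ⟨a, -, rfl⟩
  exact Finset.sum_nonneg fun _ _ => abs_nonneg _

theorem safe_of_cost_le {i : Fin d} {B u : ℤ} {σ : List A} (h : B + cost σ ≤ u) :
    Safe i B u σ := by
  induction σ generalizing u with
  | nil => simpa [cost, Safe] using h
  | cons a σ ih =>
    have h1 : |a.1 i| ≤ ∑ i, |a.1 i| :=
      Finset.single_le_sum (f := fun i => |a.1 i|) (fun _ _ => abs_nonneg _) (Finset.mem_univ i)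
    have h2 := neg_abs_le (a.1 i)
    have h3 := cost_nonneg σ
    have h4 := abs_nonneg (a.1 i)
    simp only [cost, List.map_cons, List.sum_cons] at *
    exact ⟨by linarith, ih (by linarith)⟩

@[simp] theorem label_nil {V : Type} : label ([] : List (Triple V A)) = [] := rfl

@[simp] theorem label_cons {V : Type} (t : Triple V A) (w : List (Triple V A)) :
    label (t :: w) = t.act :: label w := rfl

@[simp] theorem label_append {V : Type} (w w' : List (Triple V A)) :
    label (w ++ w') = label w ++ label w' := List.map_append

@[simp] theorem label_replicate {V : Type} (n : ℕ) (w : List (Triple V A)) :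
    label (List.replicate n w).flatten = (List.replicate n (label w)).flatten := by
  simp [label]

theorem isPath_append {V : Type} {u v : V} {w w' : List (Triple V A)} :
    IsPath u (w ++ w') v ↔ ∃ p, IsPath u w p ∧ IsPath p w' v := by
  induction w generalizing u with
  | nil => simp [IsPath]
  | cons t w ih => simp [IsPath, ih, and_assoc]

theorem isPath_replicate {V : Type} {s : V} {w : List (Triple V A)} (h : IsPath s w s) (n : ℕ) :
    IsPath s (List.replicate n w).flatten s := by
  induction n with
  | zero => simp [IsPath]
  | succ n ih =>
    rw [List.replicate_succ, List.flatten_cons]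
    exact isPath_append.2 ⟨s, h, ih⟩

/-- Actions determine a run from its source, and the only obstruction is a negative coordinate; this
lets all later safety arguments treat one coordinate at a time. -/
theorem exists_isRun {u : Conf d} {σ : List A} (h : ∀ i, Safe i 0 (u i) σ) :
    ∃ r : Prerun A, IsRun r ∧ r.src = u ∧ label r.word = σ ∧
      ∀ i, (r.tgt i : ℤ) = u i + eff σ i := by
  induction σ generalizing u with
  | nil => exact ⟨⟨u, [], u⟩, ⟨by simp, rfl⟩, rfl, rfl, by simp⟩
  | cons a σ ih =>
    have hs : ∀ i, (((u i + a.1 i : ℤ).toNat : ℕ) : ℤ) = u i + a.1 i :=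
      fun i => Int.toNat_of_nonneg (h i).2.start
    obtain ⟨r, hr, h1, h2, h3⟩ := ih (u := fun i => (u i + a.1 i : ℤ).toNat)
      fun i => by rw [hs]; exact (h i).2
    refine ⟨⟨u, ⟨u, a, r.src⟩ :: r.word, r.tgt⟩, ⟨?_, rfl, hr.2⟩, rfl, by simp [h2], fun i => ?_⟩
    · intro t ht
      rcases List.mem_cons.1 ht with rfl | ht
      · intro i
        simp only [h1]
        exact hs i
      · exact hr.1 t ht
    · simp only [h3, hs, eff_cons]
      ring

theorem IsPartialTransition.tgt_top {t : Triple (PConf d) A} (ht : IsPartialTransition t)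
    {i : Fin d} (h : t.src i = ⊤) : t.tgt i = ⊤ := by
  have := ht i
  rw [h] at this
  cases hv : t.tgt i with
  | top => rfl
  | coe m =>
    rw [hv] at this
    simp only [ENat.map_top, ENat.map_natCast, WithTop.top_add] at this
    exact absurd this (WithTop.coe_ne_top)

theorem IsPartialTransition.tgt_coe {t : Triple (PConf d) A} (ht : IsPartialTransition t)
    {i : Fin d} {n : ℕ} (h : t.src i = n) :
    ∃ m : ℕ, t.tgt i = m ∧ (m : ℤ) = n + t.act.1 i := by
  have := ht i
  rw [h] at this
  cases hv : t.tgt i with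
  | top =>
    rw [hv] at this
    simp only [ENat.map_top, ENat.map_natCast, ← WithTop.coe_add] at this
    exact absurd this.symm (WithTop.coe_ne_top)
  | coe m =>
    rw [hv] at this
    simp only [ENat.map_natCast, ← WithTop.coe_add] at this
    exact ⟨m, rfl, WithTop.coe_injective this⟩

theorem PRun.top {u v : PConf d} {σ : List A} (h : PRun u σ v) {i : Fin d} (hi : u i = ⊤) :
    v i = ⊤ := by
  obtain ⟨w, hw, hp, -⟩ := h
  induction w generalizing u with
  | nil => exact hp ▸ hi
  | cons t w ih =>
    obtain ⟨rfl, hp⟩ := hp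
    exact ih ((hw t (by simp)).tgt_top hi) (fun t' ht' => hw t' (by simp [ht'])) hp

/-- On a finite coordinate a partial run is an ordinary integer computation that stays nonnegative.
-/
theorem PRun.coe {u v : PConf d} {σ : List A} (h : PRun u σ v) {i : Fin d} {n : ℕ}
    (hi : u i = n) : Safe i 0 n σ ∧ ∃ m : ℕ, v i = m ∧ (m : ℤ) = n + eff σ i := by
  obtain ⟨w, hw, hp, rfl⟩ := h
  induction w generalizing u n with
  | nil => exact ⟨by simp [Safe], n, hp ▸ hi, by simp⟩
  | cons t w ih =>
    obtain ⟨rfl, hp⟩ := hp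
    obtain ⟨m, hm, hm'⟩ := (hw t (by simp)).tgt_coe hi
    obtain ⟨h1, l, h2, h3⟩ := ih hm (fun t' ht' => hw t' (by simp [ht'])) hp
    refine ⟨⟨by simp, hm' ▸ h1⟩, l, h2, ?_⟩
    rw [h3, hm', label_cons, eff_cons, add_assoc]

/-- A run below the source of a partial run with the same label stays below it. -/
theorem forall₂_mem_downTriple {p q : PConf d} {w : List (Triple (PConf d) A)}
    (hw : ∀ e ∈ w, IsPartialTransition e) (hp : IsPath p w q) {u v : Conf d}
    {r : List (Triple (Conf d) A)} (hr : ∀ t ∈ r, IsTransition t) (hr' : IsPath u r v)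
    (hl : label r = label w) (hu : emb u ≤ p) :
    List.Forall₂ (fun t e => t ∈ downTriple e) r w := by
  induction w generalizing p u r with
  | nil =>
    obtain rfl : r = [] := by simpa [label] using hl
    exact List.Forall₂.nil
  | cons e w ih =>
    cases r with
    | nil => simp at hl
    | cons t r =>
      obtain ⟨rfl, hp⟩ := hp
      obtain ⟨rfl, hr'⟩ := hr'
      simp only [label_cons, List.cons.injEq] at hl
      have ht : emb t.tgt ≤ e.tgt := by
        intro i
        have h1 := hr t (by simp) i
        cases hs : e.src i with
        | top => rw [(hw e (by simp)).tgt_top hs]; exact le_top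
        | coe n =>
          obtain ⟨m, hm, hm'⟩ := (hw e (by simp)).tgt_coe hs
          have h2 := hu i
          rw [hs] at h2
          simp only [emb, Nat.cast_le] at h2
          rw [hm, emb, Nat.cast_le]
          rw [hl.1] at h1
          omega
      exact List.Forall₂.cons ⟨hu, hl.1, ht⟩ (ih (fun e' he' => hw e' (by simp [he'])) hp
        (fun t' ht' => hr t' (by simp [ht'])) hr' hl.2 ht)

/-- A run that agrees with a partial run on its finite coordinates and is at least `B` on the
other ones dominates everything that is bounded by `B` and below the partial run. -/
theorem forall₂_le {F : Set (Fin d)} {B : ℕ} {p q : PConf d} {w : List (Triple (PConf d) A)}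
    (hw : ∀ e ∈ w, IsPartialTransition e) (hp : IsPath p w q)
    {u v : Conf d} {r : List (Triple (Conf d) A)}
    (hr : ∀ t ∈ r, IsTransition t) (hr' : IsPath u r v) (hl : label r = label w)
    (hu : ∀ i ∈ F, p i = u i) (hB : ∀ i ∉ F, Safe i B (u i) (label w)) :
    List.Forall₂ (fun e t => ∀ τ ∈ downTriple e, (∀ i, τ.src i ≤ B ∧ τ.tgt i ≤ B) → τ ≤ t)
      w r := by
  induction w generalizing p u r with
  | nil =>
    obtain rfl : r = [] := by simpa [label] using hl
    exact List.Forall₂.nil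
  | cons e w ih =>
    cases r with
    | nil => simp at hl
    | cons t r =>
      obtain ⟨rfl, hp⟩ := hp
      obtain ⟨rfl, hr'⟩ := hr'
      simp only [label_cons, List.cons.injEq] at hl
      have h1 := hr t (by simp)
      have ht : ∀ i ∈ F, e.tgt i = t.tgt i := by
        intro i hi
        obtain ⟨m, hm, hm'⟩ := (hw e (by simp)).tgt_coe (hu i hi)
        rw [hm, Nat.cast_inj]
        have := h1 i
        rw [hl.1] at this
        omega
      have hB' : ∀ i ∉ F, Safe i B (t.tgt i) (label w) := by
        intro i hi
        rw [h1 i, hl.1]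
        exact (hB i hi).2
      refine List.Forall₂.cons ?_ (ih (fun e' he' => hw e' (by simp [he'])) hp
        (fun t' ht' => hr t' (by simp [ht'])) hr' hl.2 ht hB')
      rintro τ ⟨h2, h3, h4⟩ h5
      refine ⟨fun i => ?_, h3.trans hl.1.symm, fun i => ?_⟩
      · by_cases hi : i ∈ F
        · have := h2 i
          rw [hu i hi] at this
          simpa [emb] using this
        · have := (hB i hi).start
          have := (h5 i).1
          show τ.src i ≤ t.src i
          omega
      · by_cases hi : i ∈ F
        · have := h4 i
          rw [ht i hi] at this
          simpa [emb] using this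
        · have := (hB' i hi).start
          have := (h5 i).2
          show τ.tgt i ≤ t.tgt i
          omega

end Words

/-! ### Subword embeddings and products of languages -/

section Sublists

theorem sublistForall₂_append {α β : Type} {R : α → β → Prop} {l₁ l₂ : List α}
    {m₁ m₂ : List β} (h₁ : List.SublistForall₂ R l₁ m₁) (h₂ : List.SublistForall₂ R l₂ m₂) :
    List.SublistForall₂ R (l₁ ++ l₂) (m₁ ++ m₂) := by
  rw [List.sublistForall₂_iff] at *
  obtain ⟨k₁, h₁, h₁'⟩ := h₁
  obtain ⟨k₂, h₂, h₂'⟩ := h₂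
  exact ⟨k₁ ++ k₂, List.rel_append h₁ h₂, h₁'.append h₂'⟩

theorem sublistForall₂_comp_forall₂ {α β γ : Type} {R : α → β → Prop} {Q : β → γ → Prop}
    {P : α → γ → Prop} (hP : ∀ a b c, R a b → Q b c → P a c) {l : List α} {m : List β}
    {n : List γ} (h : List.SublistForall₂ R l m) (h' : List.Forall₂ Q m n) :
    List.SublistForall₂ P l n := by
  induction h generalizing n with
  | nil => exact .nil
  | cons hab _ ih =>
    cases h' with
    | cons hbc h' => exact .cons (hP _ _ _ hab hbc) (ih h')
  | cons_right _ ih =>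
    cases h' with
    | cons hbc h' => exact .cons_right (ih h')

/-- Each copy of `m` supplies one letter of `l`, so as many copies as letters suffice. -/
theorem sublistForall₂_replicate {α β : Type} {R : α → β → Prop} {l : List α} {m : List β}
    (h : ∀ a ∈ l, ∃ b ∈ m, R a b) {n : ℕ} (hn : l.length ≤ n) :
    List.SublistForall₂ R l (List.replicate n m).flatten := by
  induction l generalizing n with
  | nil => exact .nil
  | cons a l ih =>
    obtain ⟨n, rfl⟩ : ∃ k, n = k + 1 := ⟨n - 1, by simp at hn; omega⟩
    obtain ⟨b, hb, hab⟩ := h a (by simp)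
    rw [List.replicate_succ, List.flatten_cons, ← List.singleton_append]
    refine sublistForall₂_append ?_ (ih (fun a' ha' => h a' (by simp [ha'])) (by simpa using hn))
    rw [List.sublistForall₂_iff]
    exact ⟨[b], by simpa using hab, by simpa using hb⟩

theorem sublistForall₂_flatten_ofFn {α β : Type} {R : α → β → Prop} {k : ℕ}
    {f : Fin k → List α} {g : Fin k → List β} (h : ∀ j, List.SublistForall₂ R (f j) (g j)) :
    List.SublistForall₂ R (List.ofFn f).flatten (List.ofFn g).flatten := by
  induction k with
  | zero => simpa using .nil
  | succ k ih =>
    simp only [List.ofFn_succ, List.flatten_cons]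
    exact sublistForall₂_append (h 0) (ih fun j => h j.succ)

theorem mem_prod_ofFn {α : Type} {k : ℕ} {L : Fin k → Language α} {w : List α} :
    w ∈ (List.ofFn L).prod ↔
      ∃ f : Fin k → List α, (∀ j, f j ∈ L j) ∧ w = (List.ofFn f).flatten := by
  induction k generalizing w with
  | zero => simp [Language.mem_one]
  | succ k ih =>
    simp only [List.ofFn_succ, List.prod_cons, List.flatten_cons, Language.mem_mul, ih]
    constructor
    · rintro ⟨a, ha, b, ⟨f, hf, rfl⟩, rfl⟩
      exact ⟨Fin.cons a f, Fin.cases ha hf, by simp⟩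
    · rintro ⟨f, hf, rfl⟩
      exact ⟨f 0, hf 0, _, ⟨fun j => f j.succ, fun j => hf j.succ, rfl⟩, rfl⟩

end Sublists

/-! ### Circulations and Eulerian cycles -/

section Eulerian

variable {d : ℕ} {A : Finset (Fin d → ℤ)} {V : Type}

open Classical in
theorem sum_count_filter {α : Type} {E : Finset α} {w : List α} (hw : ∀ e ∈ w, e ∈ E)
    (p : α → Prop) : ∑ e ∈ E with p e, w.count e = w.countP (fun e => decide (p e)) := by
  induction w with
  | nil => simp
  | cons a w ih =>
    simp only [List.count_cons, List.countP_cons, Finset.sum_add_distrib]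
    rw [ih fun e he => hw e (by simp [he])]
    congr 1
    simp [Finset.sum_ite_eq, hw a]

open Classical in
theorem isPath_countP {u v : V} {w : List (Triple V A)} (h : IsPath u w v) (s : V) :
    w.countP (fun e => decide (e.tgt = s)) + (if u = s then 1 else 0) =
      w.countP (fun e => decide (e.src = s)) + (if v = s then 1 else 0) := by
  induction w generalizing u with
  | nil => cases h; rfl
  | cons t w ih =>
    obtain ⟨rfl, h⟩ := h
    have := ih h
    simp only [List.countP_cons, decide_eq_true_eq]
    omega

open Classical in
/-- The sequence `w` is a path from `u` to `v` in `E` that uses each edge `e` at most `φ e`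
times. -/
def IsTrail (E : Finset (Triple V A)) (φ : Triple V A → ℕ) (u : V) (w : List (Triple V A))
    (v : V) : Prop :=
  (∀ e ∈ w, e ∈ E) ∧ IsPath u w v ∧ ∀ e ∈ E, w.count e ≤ φ e

/-- This bound makes a longest trail exist. -/
theorem IsTrail.length_le {E : Finset (Triple V A)} {φ : Triple V A → ℕ} {u v : V}
    {w : List (Triple V A)} (h : IsTrail E φ u w v) : w.length ≤ ∑ e ∈ E, φ e := by
  classical
  have := sum_count_filter h.1 fun _ => True
  simp only [Finset.filter_true, decide_true, List.countP_true] at this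
  rw [← this]
  refine Finset.sum_le_sum fun e he => ?_
  convert h.2.2 e he

theorem IsTrail.rotate {E : Finset (Triple V A)} {φ : Triple V A → ℕ} {u p : V}
    {w w' : List (Triple V A)} (h : IsTrail E φ u (w ++ w') u) (hw : IsPath u w p)
    (hw' : IsPath p w' u) : IsTrail E φ p (w' ++ w) p := by
  refine ⟨fun e he => h.1 e (by simpa [or_comm] using he), isPath_append.2 ⟨u, hw', hw⟩,
    fun e he => ?_⟩
  have := h.2.2 e he
  simp only [List.count_append] at *
  omega

open Classical in
/-- At each vertex of `S`, the values of `φ` on the edges entering it and on those leaving it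
have the same sum. -/
def IsCirculation (S : Finset V) (E : Finset (Triple V A)) (φ : Triple V A → ℕ) : Prop :=
  ∀ v ∈ S, ∑ e ∈ E with e.tgt = v, φ e = ∑ e ∈ E with e.src = v, φ e

open Classical in
theorem isCirculation_count {S : Finset V} {E : Finset (Triple V A)} {u : V}
    {w : List (Triple V A)} (hw : ∀ e ∈ w, e ∈ E) (hp : IsPath u w u) :
    IsCirculation S E fun e => w.count e := by
  intro v _
  rw [sum_count_filter hw, sum_count_filter hw]
  exact Nat.add_right_cancel (isPath_countP hp v)

theorem IsCirculation.add {S : Finset V} {E : Finset (Triple V A)} {φ ψ : Triple V A → ℕ}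
    (hφ : IsCirculation S E φ) (hψ : IsCirculation S E ψ) :
    IsCirculation S E fun e => φ e + ψ e := by
  intro v hv
  rw [Finset.sum_add_distrib, Finset.sum_add_distrib, hφ v hv, hψ v hv]

theorem IsCirculation.mul {S : Finset V} {E : Finset (Triple V A)} {φ : Triple V A → ℕ}
    (hφ : IsCirculation S E φ) (m : ℕ) : IsCirculation S E fun e => m * φ e := by
  intro v hv
  rw [← Finset.mul_sum, ← Finset.mul_sum, hφ v hv]

theorem IsCirculation.of_add {S : Finset V} {E : Finset (Triple V A)} {χ φ ψ : Triple V A → ℕ}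
    (hχ : IsCirculation S E χ) (hψ : IsCirculation S E ψ) (h : ∀ e ∈ E, χ e = φ e + ψ e) :
    IsCirculation S E φ := by
  intro v hv
  have key : ∀ p : Triple V A → Prop, [DecidablePred p] → ∑ e ∈ E with p e, χ e =
      ∑ e ∈ E with p e, φ e + ∑ e ∈ E with p e, ψ e := by
    intro p _
    rw [← Finset.sum_add_distrib]
    exact Finset.sum_congr rfl fun e he => h e (Finset.mem_filter.1 he).1
  have h1 := hχ v hv
  rw [key, key, hψ v hv] at h1
  exact Nat.add_right_cancel h1

open Classical in
/-- In a strongly connected graph, every positive circulation is the Parikh image of a cycle. -/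
theorem exists_eulerian_cycle {S : Finset V} {E : Finset (Triple V A)} {φ : Triple V A → ℕ}
    (hE : ∀ e ∈ E, e.src ∈ S ∧ e.tgt ∈ S)
    (hconn : ∀ u ∈ S, ∀ v ∈ S, ∃ w : List (Triple V A), (∀ e ∈ w, e ∈ E) ∧ IsPath u w v)
    (hflow : IsCirculation S E φ)
    (hpos : ∀ e ∈ E, 1 ≤ φ e) {s : V} (hs : s ∈ S) :
    ∃ w : List (Triple V A), (∀ e ∈ w, e ∈ E) ∧ IsPath s w s ∧ ∀ e ∈ E, w.count e = φ e := by
  let P : ℕ → Prop := fun n => ∃ u ∈ S, ∃ v ∈ S, ∃ w, IsTrail E φ u w v ∧ w.length = n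
  have hP0 : P 0 := ⟨s, hs, s, hs, [], ⟨by simp, rfl, by simp⟩, rfl⟩
  have hle : ∀ n, P n → n ≤ ∑ e ∈ E, φ e := by
    rintro _ ⟨_, _, _, _, w, hw, rfl⟩
    exact hw.length_le
  obtain ⟨N, hN, hmax⟩ : ∃ N, P N ∧ ∀ n, P n → n ≤ N :=
    ⟨_, Nat.findGreatest_spec (Nat.zero_le _) hP0,
      fun n hn => Nat.le_findGreatest (hle n hn) hn⟩
  -- An outgoing edge of the end with capacity left would extend a longest trail.
  have saturated : ∀ u ∈ S, ∀ v, ∀ w, IsTrail E φ u w v → w.length = N →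
      ∀ e ∈ E, e.src = v → w.count e = φ e := by
    rintro u hu v w hw hwN e he rfl
    by_contra hne
    have hlt : w.count e < φ e := lt_of_le_of_ne (hw.2.2 e he) hne
    have := hmax (N + 1) ⟨u, hu, e.tgt, (hE e he).2, w ++ [e], ⟨?_, ?_, ?_⟩, by simp [hwN]⟩
    · omega
    · intro e' he'
      rcases List.mem_append.1 he' with h | h
      · exact hw.1 e' h
      · rw [List.mem_singleton.1 h]; exact he
    · exact isPath_append.2 ⟨e.src, hw.2.1, rfl, rfl⟩
    · intro e' he'
      by_cases h : e = e'
      · subst h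
        simpa using hlt
      · simpa [List.count_append, List.count_singleton, h] using hw.2.2 e' he'
  obtain ⟨u, hu, v, hv, w, hw, hwN⟩ := hN
  -- The end of an open trail is entered once more than it is left; since its outgoing edges are
  -- saturated, the entering edges would exceed the circulation.
  obtain rfl : u = v := by
    by_contra huv
    have h1 := isPath_countP hw.2.1 v
    rw [if_neg huv, if_pos rfl, ← sum_count_filter hw.1, ← sum_count_filter hw.1] at h1
    have h2 : ∑ e ∈ E with e.src = v, w.count e = ∑ e ∈ E with e.src = v, φ e :=
      Finset.sum_congr rfl fun e he => by
        rw [Finset.mem_filter] at he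
        exact saturated u hu v w hw hwN e he.1 he.2
    have h3 : ∑ e ∈ E with e.tgt = v, w.count e ≤ ∑ e ∈ E with e.tgt = v, φ e :=
      Finset.sum_le_sum fun e he => hw.2.2 e (Finset.mem_filter.1 he).1
    have h4 := hflow v hv
    omega
  -- `Q p` says that the closed trail visits `p`. Rotating it to start at `p` gives another longest
  -- trail, so the edges leaving `p` are saturated too.
  let Q : V → Prop := fun p => ∃ w₁ w₂, w = w₁ ++ w₂ ∧ IsPath u w₁ p ∧ IsPath p w₂ u
  have sat : ∀ p ∈ S, Q p → ∀ e ∈ E, e.src = p → w.count e = φ e := by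
    rintro p hp ⟨w₁, w₂, rfl, h1, h2⟩ e he hep
    rw [← saturated p hp p (w₂ ++ w₁) (hw.rotate h1 h2) (by simpa [add_comm] using hwN) e he hep]
    simp [add_comm]
  -- Positivity of `φ` enters here: a saturated edge occurs in the trail, so its target is visited.
  -- Strong connectivity then spreads `Q` to all of `S`.
  have hstep : ∀ e ∈ E, Q e.src → Q e.tgt := by
    intro e he hq
    have h1 : 0 < w.count e := by
      rw [sat _ (hE e he).1 hq e he rfl]
      exact hpos e he
    obtain ⟨w₁, w₂, rfl⟩ := List.append_of_mem (List.count_pos_iff.1 h1)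
    obtain ⟨p, h2, rfl, h3⟩ := isPath_append.1 hw.2.1
    exact ⟨w₁ ++ [e], w₂, by simp, isPath_append.2 ⟨_, h2, rfl, rfl⟩, h3⟩
  have hpath : ∀ (l : List (Triple V A)) (p q : V), (∀ e ∈ l, e ∈ E) → IsPath p l q →
      Q p → Q q := by
    intro l
    induction l with
    | nil => rintro p q - rfl h; exact h
    | cons e l ih =>
      rintro p q hl ⟨rfl, h⟩ hq
      exact ih _ _ (fun e' he' => hl e' (by simp [he'])) h (hstep e (hl e (by simp)) hq)
  have hall : ∀ p ∈ S, Q p := by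
    intro p hp
    obtain ⟨l, hl, hl'⟩ := hconn u hu p hp
    exact hpath l u p hl hl' ⟨[], w, rfl, rfl, hw.2.1⟩
  obtain ⟨w₁, w₂, rfl, h1, h2⟩ := hall s hs
  have hr := hw.rotate h1 h2
  refine ⟨w₂ ++ w₁, hr.1, hr.2.1, fun e he => ?_⟩
  rw [← sat _ (hE e he).1 (hall _ (hE e he).1) e he rfl]
  simp [add_comm]

end Eulerian

/-! ### Pumping cycles and runs of a single marked witness graph -/

section Pumping

variable {d : ℕ} {A : Finset (Fin d → ℤ)}

theorem proj_emb_eq_iff {u : PConf d} {c : Conf d} :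
    proj (finCoords u) (emb c) = u ↔ ∀ i, u i ≠ ⊤ → u i = c i := by
  constructor
  · intro h i hi
    have := congrFun h i
    simpa [proj, finCoords, hi, emb, eq_comm] using this
  · intro h
    funext i
    by_cases hi : u i = ⊤
    · simp [proj, finCoords, hi]
    · simp [proj, finCoords, emb, h i hi]

theorem WitnessGraph.pRun (G : WitnessGraph A) {p q : PConf d} {w : List (Triple (PConf d) A)}
    (hw : ∀ e ∈ w, e ∈ G.E) (hp : IsPath p w q) : PRun p (label w) q :=
  ⟨w, fun e he => (G.edges e (hw e he)).2.2, hp, rfl⟩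

theorem WitnessGraph.cycle_coe (G : WitnessGraph A) {p : PConf d} {w : List (Triple (PConf d) A)}
    (hw : ∀ e ∈ w, e ∈ G.E) (hp : IsPath p w p) {i : Fin d} {n : ℕ} (hi : p i = n) :
    Safe i 0 n (label w) ∧ eff (label w) i = 0 := by
  obtain ⟨h1, m, h2, h3⟩ := (G.pRun hw hp).coe hi
  rw [hi, Nat.cast_inj] at h2
  exact ⟨h1, by omega⟩

/-- The effect on a finite coordinate of `x` is nonnegative because x ≤ x'. If it were zero,
iterating would leave the coordinate bounded, so the iterates could not exhaust a state with ω
there. -/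
theorem WitnessGraph.ForwardPumpable.exists_cycle {G : WitnessGraph A} {x : PConf d}
    (h : G.ForwardPumpable x) : ∃ c : List (Triple (PConf d) A), (∀ e ∈ c, e ∈ G.E) ∧
      IsPath G.s c G.s ∧ ∀ i (n : ℕ), x i = n →
        Safe i 0 n (label c) ∧ (G.s i = ⊤ → 1 ≤ eff (label c) i) := by
  obtain ⟨σ, ⟨c, hc, hp, rfl⟩, ⟨x', hx', hle⟩, xs, hxs, hU⟩ := h
  refine ⟨c, hc, hp, fun i n hn => ?_⟩
  obtain ⟨h1, m, hm, hm'⟩ := hx'.coe hn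
  refine ⟨h1, fun hs => ?_⟩
  have h2 := hle i
  rw [hn, hm, Nat.cast_le] at h2
  by_contra hlt
  have h0 : eff (label c) i = 0 := by omega
  -- The test vector exceeds the constant value n at `i` by one and vanishes elsewhere.
  have hmem : (fun j => if j = i then n + 1 else 0 : Conf d) ∈ downConf G.s := by
    intro j
    by_cases hj : j = i
    · rw [hj, hs]; exact le_top
    · simp [emb, hj]
  rw [hU, Set.mem_iUnion] at hmem
  obtain ⟨k, hk⟩ := hmem
  obtain ⟨-, l, hl, hl'⟩ := (hxs k).coe hn
  rw [eff_replicate, h0] at hl'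
  have h3 := hk i
  simp only [emb, if_true, hl, Nat.cast_le] at h3
  omega

theorem WitnessGraph.BackwardPumpable.exists_cycle {G : WitnessGraph A} {y : PConf d}
    (h : G.BackwardPumpable y) : ∃ c : List (Triple (PConf d) A), (∀ e ∈ c, e ∈ G.E) ∧
      IsPath G.s c G.s ∧ ∀ i (n : ℕ), y i = n →
        Safe i 0 (n - eff (label c) i) (label c) ∧ (G.s i = ⊤ → eff (label c) i ≤ -1) := by
  -- Partial runs can be read backwards: ω persists along a run, so a finite target coordinate
  -- forces a finite source coordinate.
  have key : ∀ {u v : PConf d} {σ : List A} (_ : PRun u σ v) {i : Fin d} {n : ℕ} (_ : v i = n),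
      ∃ m : ℕ, u i = m ∧ (n : ℤ) = m + eff σ i ∧ Safe i 0 m σ := by
    intro u v σ h i n hn
    cases hu : u i with
    | top => exact absurd (h.top hu) (by rw [hn]; exact ENat.natCast_ne_top n)
    | coe m =>
      obtain ⟨h1, l, hl, hl'⟩ := h.coe hu
      rw [hn, Nat.cast_inj] at hl
      exact ⟨m, rfl, hl ▸ hl', h1⟩
  obtain ⟨σ, ⟨c, hc, hp, rfl⟩, ⟨y', hy', hle⟩, ys, hys, hU⟩ := h
  refine ⟨c, hc, hp, fun i n hn => ?_⟩
  obtain ⟨m, hm, hm', h1⟩ := key hy' hn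
  refine ⟨by rwa [hm', add_sub_cancel_right], fun hs => ?_⟩
  have h2 := hle i
  rw [hn, hm, Nat.cast_le] at h2
  by_contra hlt
  have h0 : eff (label c) i = 0 := by omega
  have hmem : (fun j => if j = i then n + 1 else 0 : Conf d) ∈ downConf G.s := by
    intro j
    by_cases hj : j = i
    · rw [hj, hs]; exact le_top
    · simp [emb, hj]
  rw [hU, Set.mem_iUnion] at hmem
  obtain ⟨k, hk⟩ := hmem
  obtain ⟨l, hl, hl', -⟩ := key (hys k) hn
  rw [eff_replicate, h0] at hl'
  have h3 := hk i
  simp only [emb, if_true, hl, Nat.cast_le] at h3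
  omega

/-- The right-hand side is (t − k)β + k(β + δ): between k = 0 and k = t it interpolates between two
values that are at least t. -/
theorem le_mul_add_mul {t k : ℕ} (hk : k ≤ t) {β δ : ℤ} (h₁ : 1 ≤ β) (h₂ : 1 ≤ β + δ) :
    (t : ℤ) ≤ t * β + k * δ := by
  have hk' : (0 : ℤ) ≤ t - k := by omega
  nlinarith [mul_nonneg hk' (sub_nonneg.2 h₁), mul_nonneg (Nat.cast_nonneg (α := ℤ) k)
    (sub_nonneg.2 h₂)]

/-- Safety, on an unbounded coordinate, of a forward pumping sequence `σ`, followed by a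
sequence `μ`, a pumping sequence `θ` and a backward pumping sequence `ρ`. -/
theorem safe_pumping {i : Fin d} {σ μ θ ρ : List A} {X Y p q : ℤ} {B t : ℕ}
    (hX : 0 ≤ X) (hY : 0 ≤ Y) (hp : 0 ≤ p) (hq : 0 ≤ q)
    (hσ : (p = 0 ∧ Safe i 0 X σ) ∨ 1 ≤ p) (hσ' : 1 ≤ p + eff σ i)
    (hρ : (q = 0 ∧ Safe i 0 (Y - eff ρ i) ρ) ∨ 1 ≤ q) (hρ' : 1 ≤ q - eff ρ i)
    (hμ : X + p + eff μ i = Y + q) (hθ : p + eff σ i + eff θ i + eff ρ i = q)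
    (ht : B + cost σ + cost μ + cost θ + cost ρ ≤ t) :
    Safe i 0 (X + p + t * p) (List.replicate t σ).flatten ∧
    Safe i 0 (X + p + t * (p + eff σ i)) μ ∧
    Safe i B (Y + q + t * (p + eff σ i)) (List.replicate t θ).flatten ∧
    Safe i 0 (Y + q + t * (q - eff ρ i)) (List.replicate t ρ).flatten := by
  have c1 := cost_nonneg σ
  have c2 := cost_nonneg μ
  have c3 := cost_nonneg θ
  have c4 := cost_nonneg ρ
  have ht0 : (0 : ℤ) ≤ t := Nat.cast_nonneg t
  have hB0 : (0 : ℤ) ≤ B := Nat.cast_nonneg B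
  have e1 := le_mul_add_mul (Nat.zero_le t) hσ' (by simpa using hσ' : 1 ≤ p + eff σ i + 0)
  have e2 := le_mul_add_mul (Nat.zero_le t) hρ' (by simpa using hρ' : 1 ≤ q - eff ρ i + 0)
  simp only [Nat.cast_zero, zero_mul, add_zero] at e1 e2
  refine ⟨?_, safe_of_cost_le (by linarith), ?_, ?_⟩
  -- If p = 0, `σ` is safe from X and its effect is positive, so later copies start higher. If p ≥
  -- 1, the starts interpolate between (t times) p and p + eff σ, and exceed the cost of `σ`.
  · rcases hσ with ⟨rfl, h⟩ | h
    · refine h.replicate (by linarith [mul_nonneg ht0 hp]) fun k _ => ?_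
      have : 0 ≤ (k : ℤ) * eff σ i := mul_nonneg (Nat.cast_nonneg k) (by linarith)
      linarith
    · refine (safe_of_cost_le (u := cost σ) (by linarith)).replicate
        (by linarith [mul_nonneg ht0 hp]) fun k hk => ?_
      have := le_mul_add_mul hk.le h hσ'
      linarith
  -- By `hθ` the starting values interpolate between the slopes p + eff σ and q − eff ρ, both at
  -- least 1.
  · refine (safe_of_cost_le (u := B + cost θ) le_rfl).replicate (by linarith) fun k hk => ?_
    have := le_mul_add_mul (δ := eff θ i) hk.le hσ' (by linarith)
    linarith
  · rcases hρ with ⟨rfl, h⟩ | h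
    · refine h.replicate (by linarith) fun k hk => ?_
      -- The k-th copy is followed by t − k − 1 others, so it starts at least as high as the last
      -- one, which starts at Y − eff ρ.
      have h1 : (1 : ℤ) ≤ t - k := by omega
      have := mul_le_mul_of_nonneg_right h1 (by linarith : 0 ≤ - eff ρ i)
      linarith
    · refine (safe_of_cost_le (u := cost ρ) (by linarith)).replicate
        (by linarith) fun k hk => ?_
      have := le_mul_add_mul (δ := eff ρ i) hk.le hρ' (by linarith)
      linarith

open Classical in
theorem eff_label {V : Type} {E : Finset (Triple V A)} {w : List (Triple V A)}
    (hw : ∀ e ∈ w, e ∈ E) (i : Fin d) :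
    eff (label w) i = ∑ e ∈ E, (w.count e : ℤ) * e.act.1 i := by
  induction w with
  | nil => simp
  | cons a w ih =>
    rw [label_cons, eff_cons, ih fun e he => hw e (by simp [he])]
    simp only [List.count_cons, Nat.cast_add, add_mul, Finset.sum_add_distrib]
    simp [hw a, add_comm]

theorem exists_bound (w : List (Triple (Conf d) A)) :
    ∃ B : ℕ, ∀ τ ∈ w, ∀ i, τ.src i ≤ B ∧ τ.tgt i ≤ B := by
  induction w with
  | nil => exact ⟨0, by simp⟩
  | cons τ w ih =>
    obtain ⟨B, hB⟩ := ih
    refine ⟨B + ∑ i, (τ.src i + τ.tgt i), fun τ' h i => ?_⟩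
    rcases List.mem_cons.1 h with rfl | h
    · have := Finset.single_le_sum (f := fun i => τ'.src i + τ'.tgt i)
        (fun _ _ => Nat.zero_le _) (Finset.mem_univ i)
      have h' : τ'.src i + τ'.tgt i ≤ _ := this
      omega
    · have := hB τ' h i
      omega

theorem MarkedWitnessGraph.sIn_eq (M : MarkedWitnessGraph A) {i : Fin d} (h : M.G.s i ≠ ⊤) :
    M.sIn i = M.G.s i := by
  have := congrFun M.proj_in i
  simpa [proj, WitnessGraph.F, finCoords, h] using this

theorem MarkedWitnessGraph.sOut_eq (M : MarkedWitnessGraph A) {i : Fin d} (h : M.G.s i ≠ ⊤) :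
    M.sOut i = M.G.s i := by
  have := congrFun M.proj_out i
  simpa [proj, WitnessGraph.F, finCoords, h] using this

/-- The part of the linear system of a marked witness graph that concerns the edges. -/
def IsFlow (G : WitnessGraph A) (x : Conf d) (φ : Triple (PConf d) A → ℕ) (y : Conf d) : Prop :=
  IsCirculation G.S G.E φ ∧
    ∀ i, (y i : ℤ) = x i + ∑ e ∈ G.E, (φ e : ℤ) * e.act.1 i

open Classical in
theorem WitnessGraph.exists_cycle_of_flow (G : WitnessGraph A) {φ : Triple (PConf d) A → ℕ}
    (hφ : IsCirculation G.S G.E φ)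
    (hpos : ∀ e ∈ G.E, 1 ≤ φ e) :
    ∃ w : List (Triple (PConf d) A), (∀ e ∈ w, e ∈ G.E) ∧ IsPath G.s w G.s ∧
      (∀ e ∈ G.E, e ∈ w) ∧
      ∀ i, eff (label w) i = ∑ e ∈ G.E, (φ e : ℤ) * e.act.1 i := by
  obtain ⟨w, h1, h2, h3⟩ := exists_eulerian_cycle (fun e he => ⟨(G.edges e he).1,
    (G.edges e he).2.1⟩) G.stronglyConnected hφ hpos G.s_mem
  refine ⟨w, h1, h2, fun e he => List.count_pos_iff.1 ?_, fun i => ?_⟩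
  · rw [h3 e he]
    exact hpos e he
  · rw [eff_label h1]
    exact Finset.sum_congr rfl fun e he => by rw [h3 e he]

open Classical in
/-- A large multiple of a positive circulation can be diminished by two cycles. -/
theorem WitnessGraph.exists_cycle_sub (G : WitnessGraph A) {x y : Conf d}
    {φ : Triple (PConf d) A → ℕ} (h : IsFlow G x φ y) (hpos : ∀ e ∈ G.E, 1 ≤ φ e)
    {c c' : List (Triple (PConf d) A)} (hc : ∀ e ∈ c, e ∈ G.E) (hcp : IsPath G.s c G.s)
    (hc' : ∀ e ∈ c', e ∈ G.E) (hcp' : IsPath G.s c' G.s) {m : ℕ}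
    (hm : c.length + c'.length + 1 ≤ m) :
    ∃ w : List (Triple (PConf d) A), (∀ e ∈ w, e ∈ G.E) ∧ IsPath G.s w G.s ∧
      (∀ e ∈ G.E, e ∈ w) ∧
      ∀ i, m * (x i : ℤ) + eff (label c) i + eff (label w) i + eff (label c') i = m * y i := by
  -- Truncated subtraction is harmless: m φ is at least m, which exceeds the total length of the two
  -- cycles.
  have hψ : ∀ e ∈ G.E, 1 ≤ m * φ e - c.count e - c'.count e ∧
      m * φ e = (m * φ e - c.count e - c'.count e) + c.count e + c'.count e := by
    intro e he
    have h1 := c.count_le_length (a := e)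
    have h2 := c'.count_le_length (a := e)
    have h3 := Nat.mul_le_mul_left m (hpos e he)
    omega
  obtain ⟨w, h1, h2, h3, h4⟩ := G.exists_cycle_of_flow
    (φ := fun e => m * φ e - c.count e - c'.count e)
    ((h.1.mul m).of_add ((isCirculation_count hc hcp).add (isCirculation_count hc' hcp'))
      fun e he => by rw [← add_assoc]; exact (hψ e he).2) fun e he => (hψ e he).1
  refine ⟨w, h1, h2, h3, fun i => ?_⟩
  rw [h4, h.2 i, eff_label hc, eff_label hc', mul_add, Finset.mul_sum, add_assoc, add_assoc,
    add_right_inj, ← Finset.sum_add_distrib, ← Finset.sum_add_distrib]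
  refine Finset.sum_congr rfl fun e he => ?_
  have : (m : ℤ) * φ e = ((m * φ e - c.count e - c'.count e : ℕ) : ℤ) + c.count e + c'.count e :=
    mod_cast (hψ e he).2
  rw [← mul_assoc, this]
  ring

-- The witness is c^t μ θ^t c'^t, whose edge counts add up to φ₀ + (t+1)mφ₁. The order of
-- quantifiers matters: `N` does not depend on the word, and the endpoints depend only on m and t,
-- so both can later be chosen uniformly over the sequence.
open Classical in
theorem MarkedWitnessGraph.exists_runs (M : MarkedWitnessGraph A)
    (hf : M.G.ForwardPumpable M.sIn) (hb : M.G.BackwardPumpable M.sOut)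
    {x₀ x₁ y₀ y₁ : Conf d} {φ₀ φ₁ : Triple (PConf d) A → ℕ}
    (h₀ : IsFlow M.G x₀ φ₀ y₀) (h₁ : IsFlow M.G x₁ φ₁ y₁) (hpos : ∀ e ∈ M.G.E, 1 ≤ φ₁ e)
    (hx₀ : ∀ i, M.sIn i ≠ ⊤ → M.sIn i = x₀ i) (hy₀ : ∀ i, M.sOut i ≠ ⊤ → M.sOut i = y₀ i)
    (hx₁ : ∀ i, M.sIn i ≠ ⊤ → x₁ i = 0) (hy₁ : ∀ i, M.sOut i ≠ ⊤ → y₁ i = 0)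
    (hx₁' : ∀ i, M.sIn i = ⊤ → 1 ≤ x₁ i) (hy₁' : ∀ i, M.sOut i = ⊤ → 1 ≤ y₁ i) :
    ∃ N : ℕ, ∀ m ≥ N, ∀ w ∈ starAtom (⋃ e ∈ M.G.E, downTriple e), ∃ T : ℕ, ∀ t ≥ T,
      ∃ r ∈ M.runs, (∀ i, r.src i = x₀ i + (t + 1) * (m * x₁ i)) ∧
        (∀ i, r.tgt i = y₀ i + (t + 1) * (m * y₁ i)) ∧
        List.SublistForall₂ (· ≤ ·) w r.word := by
  obtain ⟨c, hc, hcp, hcs⟩ := hf.exists_cycle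
  obtain ⟨c', hc', hcp', hcs'⟩ := hb.exists_cycle
  -- The lengths keep θ's circulation positive; the costs give m x₁ + eff c ≥ 1 and m y₁ − eff c' ≥
  -- 1 on ω-coordinates of the markings.
  refine ⟨c.length + c'.length + 1 + (cost (label c)).toNat + (cost (label c')).toNat,
    fun m hm w hw => ?_⟩
  obtain ⟨θ, hθ, hθp, hθE, hθe⟩ :=
    M.G.exists_cycle_sub h₁ hpos hc hcp hc' hcp' (m := m) (by omega)
  obtain ⟨μ, hμ, hμp, -, hμe⟩ := M.G.exists_cycle_of_flow (φ := fun e => φ₀ e + m * φ₁ e)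
    (h₀.1.add (h₁.1.mul m))
    fun e he => by nlinarith [hpos e he]
  have hμe' : ∀ i, (x₀ i : ℤ) + m * x₁ i + eff (label μ) i = y₀ i + m * y₁ i := by
    intro i
    rw [hμe, h₀.2, h₁.2]
    push_cast
    simp only [add_mul, Finset.sum_add_distrib, mul_add, Finset.mul_sum, mul_assoc]
    ring
  obtain ⟨B, hB⟩ := exists_bound w
  -- The length of `w` provides enough copies of θ; the remaining terms are those required by
  -- `safe_pumping`.
  refine ⟨w.length + (B + cost (label c) + cost (label μ) + cost (label θ)
    + cost (label c')).toNat, fun t ht => ?_⟩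
  have ht' : B + cost (label c) + cost (label μ) + cost (label θ) + cost (label c') ≤ t :=
    (Int.self_le_toNat _).trans (by omega)
  have hfin : ∀ i, M.G.s i ≠ ⊤ → M.G.s i = x₀ i ∧ x₁ i = 0 ∧ y₀ i = x₀ i ∧ y₁ i = 0 := by
    intro i hi
    have e1 := M.sIn_eq hi
    have e2 := M.sOut_eq hi
    have e3 := hx₀ i (e1 ▸ hi)
    have e4 := hy₀ i (e2 ▸ hi)
    refine ⟨e1 ▸ e3, hx₁ i (e1 ▸ hi), ?_, hy₁ i (e2 ▸ hi)⟩
    rw [← Nat.cast_inj (R := ℕ∞), ← e3, ← e4, e1, e2]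
  -- Where the marking is ω, positivity of x₁ or y₁ pays for the pumping cycle; where it is finite,
  -- x₁ or y₁ vanishes and the pumping property takes over.
  have safeInf : ∀ i, M.G.s i = ⊤ → _ ∧ _ ∧ _ ∧ _ := fun i hi =>
    safe_pumping (i := i) (σ := label c) (μ := label μ) (θ := label θ) (ρ := label c')
      (X := x₀ i) (Y := y₀ i) (p := m * x₁ i) (q := m * y₁ i) (B := B) (t := t)
      (by positivity) (by positivity) (by positivity) (by positivity)
      (by
        by_cases h : M.sIn i = ⊤
        · right
          have := hx₁' i h
          exact_mod_cast Nat.mul_pos (by omega : 0 < m) this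
        · left
          exact ⟨by simp [hx₁ i h], (hcs i _ (hx₀ i h)).1⟩)
      (by
        by_cases h : M.sIn i = ⊤
        · have h1 : (m : ℤ) * 1 ≤ m * x₁ i :=
            mul_le_mul_of_nonneg_left (mod_cast hx₁' i h) (by positivity)
          have h2 := (abs_le.1 (abs_eff_le_cost (label c) i)).1
          omega
        · have := (hcs i _ (hx₀ i h)).2 hi
          simp only [hx₁ i h, Nat.cast_zero, mul_zero, zero_add]
          exact this)
      (by
        by_cases h : M.sOut i = ⊤
        · right
          have := hy₁' i h
          exact_mod_cast Nat.mul_pos (by omega : 0 < m) this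
        · left
          exact ⟨by simp [hy₁ i h], (hcs' i _ (hy₀ i h)).1⟩)
      (by
        by_cases h : M.sOut i = ⊤
        · have h1 : (m : ℤ) * 1 ≤ m * y₁ i :=
            mul_le_mul_of_nonneg_left (mod_cast hy₁' i h) (by positivity)
          have h2 := (abs_le.1 (abs_eff_le_cost (label c') i)).2
          omega
        · have := (hcs' i _ (hy₀ i h)).2 hi
          simp only [hy₁ i h, Nat.cast_zero, mul_zero, zero_sub]
          linarith)
      (hμe' i) (hθe i) ht'
  have safeFin : ∀ i, M.G.s i ≠ ⊤ → ∀ l : List (Triple (PConf d) A), (∀ e ∈ l, e ∈ M.G.E) →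
      IsPath M.G.s l M.G.s → Safe i 0 (x₀ i) (label l) ∧ eff (label l) i = 0 :=
    fun i hi l hl hlp => M.G.cycle_coe hl hlp (hfin i hi).1
  have repE : ∀ {l : List (Triple (PConf d) A)}, (∀ e ∈ l, e ∈ M.G.E) →
      ∀ e ∈ (List.replicate t l).flatten, e ∈ M.G.E := by
    intro l hl e he
    obtain ⟨l', h1, h2⟩ := List.mem_flatten.1 he
    exact hl e ((List.mem_replicate.1 h1).2 ▸ h2)
  obtain ⟨r₁, hr₁, hs₁, hl₁, ht₁⟩ := exists_isRun
    (u := fun i => x₀ i + (t + 1) * (m * x₁ i))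
    (σ := label ((List.replicate t c).flatten ++ μ)) (fun i => by
      by_cases hi : M.G.s i = ⊤
      · obtain ⟨h1, h2, -, -⟩ := safeInf i hi
        rw [label_append, label_replicate, safe_append, eff_replicate]
        push_cast
        refine ⟨?_, ?_⟩
        · convert h1 using 1; ring
        · convert h2 using 1; ring
      · simp only [(hfin i hi).2.1, mul_zero, add_zero]
        refine (safeFin i hi _ (fun e he => ?_)
          (isPath_append.2 ⟨_, isPath_replicate hcp t, hμp⟩)).1
        rcases List.mem_append.1 he with he | he
        exacts [repE hc e he, hμ e he])
  have ht₁' : ∀ i, (r₁.tgt i : ℤ) = y₀ i + m * y₁ i + t * (m * x₁ i + eff (label c) i) := by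
    intro i
    rw [ht₁, ← hμe' i, label_append, label_replicate, eff_append, eff_replicate]
    push_cast
    ring
  have hF₁ : ∀ i, M.G.s i ≠ ⊤ → r₁.tgt i = x₀ i := by
    intro i hi
    have := ht₁' i
    rw [(hfin i hi).2.1, (hfin i hi).2.2.1, (hfin i hi).2.2.2, (safeFin i hi c hc hcp).2] at this
    simpa using this
  obtain ⟨r₂, hr₂, hs₂, hl₂, ht₂⟩ := exists_isRun
    (u := r₁.tgt) (σ := label (List.replicate t θ).flatten) (fun i => by
      by_cases hi : M.G.s i = ⊤
      · rw [label_replicate, ht₁']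
        exact (safeInf i hi).2.2.1.mono_left (Nat.cast_nonneg B)
      · rw [hF₁ i hi]
        exact (safeFin i hi _ (repE hθ) (isPath_replicate hθp t)).1)
  have ht₂' : ∀ i, (r₂.tgt i : ℤ) = y₀ i + m * y₁ i + t * (m * y₁ i - eff (label c') i) := by
    intro i
    rw [ht₂, ht₁', label_replicate, eff_replicate]
    have := hθe i
    linear_combination (t : ℤ) * this
  have hF₂ : ∀ i, M.G.s i ≠ ⊤ → r₂.tgt i = x₀ i := by
    intro i hi
    have := ht₂' i
    rw [(hfin i hi).2.2.1, (hfin i hi).2.2.2, (safeFin i hi c' hc' hcp').2] at this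
    simpa using this
  obtain ⟨r₃, hr₃, hs₃, hl₃, ht₃⟩ := exists_isRun
    (u := r₂.tgt) (σ := label (List.replicate t c').flatten) (fun i => by
      by_cases hi : M.G.s i = ⊤
      · rw [label_replicate, ht₂']
        exact (safeInf i hi).2.2.2
      · rw [hF₂ i hi]
        exact (safeFin i hi _ (repE hc') (isPath_replicate hcp' t)).1)
  have ht₃' : ∀ i, r₃.tgt i = y₀ i + (t + 1) * (m * y₁ i) := by
    intro i
    have := ht₃ i
    rw [ht₂', label_replicate, eff_replicate] at this
    rw [← Nat.cast_inj (R := ℤ), this]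
    push_cast
    ring
  -- Only the middle part θ^t has to dominate `w`; the other two parts are skipped by the embedding.
  have cover := forall₂_le (F := M.G.F) (B := B) (fun e he => (M.G.edges e (repE hθ e he)).2.2)
    (isPath_replicate hθp t) hr₂.1 hr₂.2 hl₂
    (fun i hi => by rw [hs₂, hF₁ i hi]; exact (hfin i hi).1)
    (fun i hi => by
      rw [hs₂, ht₁', label_replicate]
      exact (safeInf i (by simpa [WitnessGraph.F, finCoords] using hi)).2.2.1)
  have hsub : List.SublistForall₂ (· ≤ ·) w r₂.word := by
    refine sublistForall₂_comp_forall₂ (R := fun τ e => τ ∈ downTriple e ∧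
      ∀ i, τ.src i ≤ B ∧ τ.tgt i ≤ B) (fun τ e t h h' => h' τ h.1 h.2)
      (sublistForall₂_replicate (fun τ hτ => ?_) (by omega)) cover
    obtain ⟨e, he, he'⟩ := Set.mem_iUnion₂.1 (hw τ hτ)
    exact ⟨e, hθE e he, he', hB τ hτ⟩
  refine ⟨⟨r₁.src, r₁.word ++ (r₂.word ++ r₃.word), r₃.tgt⟩, ⟨⟨?_, ?_⟩, ?_, ?_, ?_⟩,
    fun i => by simp [hs₁], ht₃', ?_⟩
  · intro τ hτ
    rcases List.mem_append.1 hτ with h | h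
    · exact hr₁.1 τ h
    · rcases List.mem_append.1 h with h | h
      exacts [hr₂.1 τ h, hr₃.1 τ h]
  · exact isPath_append.2 ⟨_, hr₁.2, isPath_append.2 ⟨_, hs₂ ▸ hr₂.2, hs₃ ▸ hr₃.2⟩⟩
  · refine ⟨((List.replicate t c).flatten ++ μ) ++ ((List.replicate t θ).flatten ++
      (List.replicate t c').flatten), fun e he => ?_, isPath_append.2 ⟨_, isPath_append.2
        ⟨_, isPath_replicate hcp t, hμp⟩, isPath_append.2 ⟨_, isPath_replicate hθp t,
          isPath_replicate hcp' t⟩⟩, ?_⟩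
    · simp only [List.mem_append] at he
      rcases he with (he | he) | he | he
      exacts [repE hc e he, hμ e he, repE hθ e he, repE hc' e he]
    · rw [label_append _ (_ ++ _), label_append r₁.word, label_append r₂.word, hl₁, hl₂, hl₃,
        ← label_append (List.replicate t θ).flatten]
  · refine proj_emb_eq_iff.2 fun i hi => ?_
    simp only [hs₁, hx₁ i hi, mul_zero, add_zero]
    exact hx₀ i hi
  · refine proj_emb_eq_iff.2 fun i hi => ?_
    simp only [ht₃', hy₁ i hi, mul_zero, add_zero]
    exact hy₀ i hi
  · simpa using sublistForall₂_append (.nil : List.SublistForall₂ _ [] r₁.word)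
      (sublistForall₂_append hsub (.nil : List.SublistForall₂ _ [] r₃.word))

end Pumping

/-! ### The linear system and a positive homogeneous solution -/

section Linear

variable {d : ℕ} {A : Finset (Fin d → ℤ)}

open Classical in
/-- The extension by zero of a function on a finite set. -/
noncomputable def extendZero {α : Type} {E : Finset α} (ψ : E → ℕ) (e : α) : ℕ :=
  if h : e ∈ E then ψ ⟨e, h⟩ else 0

theorem extendZero_coe {α : Type} {E : Finset α} (ψ : E → ℕ) (e : E) :
    extendZero ψ e.1 = ψ e := by simp [extendZero]

theorem extendZero_add {α : Type} {E : Finset α} (ψ ψ' : E → ℕ) (e : α) :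
    extendZero (ψ + ψ') e = extendZero ψ e + extendZero ψ' e := by
  unfold extendZero
  split <;> simp

theorem sum_extendZero {α : Type} {E : Finset α} (ψ : E → ℕ) (p : α → Prop)
    {_ : DecidablePred p} {_ : DecidablePred fun e : E => p e.1} :
    ∑ e ∈ E with p e, extendZero ψ e = ∑ e : E with p e.1, ψ e := by
  rw [Finset.sum_filter, Finset.sum_filter, ← Finset.sum_coe_sort]
  simp only [extendZero_coe]

theorem IsFlow.add {G : WitnessGraph A} {x y x' y' : Conf d} {φ φ' : Triple (PConf d) A → ℕ}
    (h : IsFlow G x φ y) (h' : IsFlow G x' φ' y') :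
    IsFlow G (x + x') (fun e => φ e + φ' e) (y + y') := by
  refine ⟨h.1.add h'.1, fun i => ?_⟩
  have h1 := h.2 i
  have h2 := h'.2 i
  simp only [Pi.add_apply, Nat.cast_add, add_mul, Finset.sum_add_distrib]
  linarith

theorem IsFlow.of_add {G : WitnessGraph A} {x y x' y' : Conf d} {φ φ' : Triple (PConf d) A → ℕ}
    (h : IsFlow G x φ y) (h' : IsFlow G (x + x') (fun e => φ e + φ' e) (y + y')) :
    IsFlow G x' φ' y' := by
  refine ⟨h'.1.of_add h.1 fun e _ => add_comm _ _, fun i => ?_⟩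
  have h1 := h.2 i
  have h2 := h'.2 i
  simp only [Pi.add_apply, Nat.cast_add, add_mul, Finset.sum_add_distrib] at h2
  linarith

namespace MWGSeq

variable {x y : Conf d} (ξ : MWGSeq A x y)

theorem isFlow_of_mem_L {z : ξ.Tuple} (hz : z ∈ ξ.L) (j : Fin (ξ.k + 1)) :
    IsFlow (ξ.M j).G (z j).1 (extendZero (z j).2.1) (z j).2.2 := by
  refine ⟨fun v hv => ?_, fun i => ?_⟩
  · exact (sum_extendZero (z j).2.1 fun e => e.tgt = v).trans
      ((hz.1 j v hv).trans (sum_extendZero (z j).2.1 fun e => e.src = v).symm)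
  · rw [hz.2.1 j i, ← Finset.sum_coe_sort (ξ.M j).G.E]
    simp only [extendZero_coe]

/-- The solutions of the homogeneous linear system associated with `ξ`. -/
def homSolutions : AddSubmonoid ξ.Tuple where
  carrier := {h | (∀ j, IsFlow (ξ.M j).G (h j).1 (extendZero (h j).2.1) (h j).2.2) ∧
    (∀ j : Fin ξ.k, (h j.succ).1 = (h j.castSucc).2.2) ∧
    ∀ j i, ((ξ.M j).sIn i ≠ ⊤ → (h j).1 i = 0) ∧ ((ξ.M j).sOut i ≠ ⊤ → (h j).2.2 i = 0)}
  zero_mem' := by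
    refine ⟨fun j => ⟨fun v _ => ?_, fun i => ?_⟩, fun j => rfl, fun j i => ⟨fun _ => rfl,
      fun _ => rfl⟩⟩ <;> simp [extendZero]
  add_mem' := by
    rintro h h' ⟨h1, h2, h3⟩ ⟨h1', h2', h3'⟩
    refine ⟨fun j => ?_, fun j => ?_, fun j i => ⟨fun hi => ?_, fun hi => ?_⟩⟩
    · have := (h1 j).add (h1' j)
      simp only [← extendZero_add] at this
      exact this
    · exact congrArg₂ (· + ·) (h2 j) (h2' j)
    · exact Nat.add_eq_zero_iff.2 ⟨(h3 j i).1 hi, (h3' j i).1 hi⟩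
    · exact Nat.add_eq_zero_iff.2 ⟨(h3 j i).2 hi, (h3' j i).2 hi⟩

variable {ξ}

theorem mem_homSolutions_of_add_mem {z h : ξ.Tuple} (hz : z ∈ ξ.L) (hzh : z + h ∈ ξ.L) :
    h ∈ ξ.homSolutions := by
  refine ⟨fun j => ?_, fun j => ?_, fun j i => ⟨fun hi => ?_, fun hi => ?_⟩⟩
  · refine (ξ.isFlow_of_mem_L hz j).of_add ?_
    simp only [← extendZero_add]
    exact ξ.isFlow_of_mem_L hzh j
  · funext i
    have e1 := hz.2.2.1 j i
    have e2 := hzh.2.2.1 j i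
    simp only [Pi.add_apply, Prod.fst_add, Prod.snd_add, Nat.cast_add] at e1 e2
    omega
  · have e1 := proj_emb_eq_iff.1 (hz.2.2.2 j).1 i hi
    have e2 := proj_emb_eq_iff.1 (hzh.2.2.2 j).1 i hi
    rw [e1, Nat.cast_inj] at e2
    simp only [Pi.add_apply, Prod.fst_add] at e2
    omega
  · have e1 := proj_emb_eq_iff.1 (hz.2.2.2 j).2 i hi
    have e2 := proj_emb_eq_iff.1 (hzh.2.2.2 j).2 i hi
    rw [e1, Nat.cast_inj] at e2
    simp only [Pi.add_apply, Prod.snd_add] at e2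
    omega

/-- A component that is unbounded on the solutions is positive on a homogeneous solution. -/
theorem exists_homSolution_pos (f : ξ.Tuple →+ ℕ) (hf : ∀ N, ∃ z ∈ ξ.L, N ≤ f z) :
    ∃ h ∈ ξ.homSolutions, 1 ≤ f h := by
  choose z hz hN using hf
  obtain ⟨g, hg⟩ := (wellQuasiOrdered_le (α := ξ.Tuple)).exists_monotone_subseq z
  -- Since g n ≥ n, the index f (z (g 0)) + 1 makes `f` strictly larger on the later solution than
  -- on the earlier one below it.
  obtain ⟨h, hh⟩ := exists_add_of_le (hg 0 (f (z (g 0)) + 1) (Nat.zero_le _))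
  refine ⟨h, mem_homSolutions_of_add_mem (hz (g 0)) (hh ▸ hz _), ?_⟩
  have h1 := hN (g (f (z (g 0)) + 1))
  have h2 := g.strictMono.le_apply (x := f (z (g 0)) + 1)
  rw [hh, map_add f] at h1
  omega

/-- Homogeneous solutions are natural-valued and closed under sums, so positivity on one component
survives adding the solutions for the others. -/
theorem exists_homSolution_forall_pos {ι : Type} [Fintype ι] (f : ι → ξ.Tuple →+ ℕ) :
    ∃ h ∈ ξ.homSolutions, ∀ c, (∀ N, ∃ z ∈ ξ.L, N ≤ f c z) → 1 ≤ f c h := by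
  have : ∀ c, ∃ h ∈ ξ.homSolutions, (∀ N, ∃ z ∈ ξ.L, N ≤ f c z) → 1 ≤ f c h := by
    intro c
    by_cases hc : ∀ N, ∃ z ∈ ξ.L, N ≤ f c z
    · obtain ⟨h, hh, h1⟩ := exists_homSolution_pos (f c) hc
      exact ⟨h, hh, fun _ => h1⟩
    · exact ⟨0, ξ.homSolutions.zero_mem, fun h => absurd h hc⟩
  choose h hh h1 using this
  refine ⟨∑ c, h c, ξ.homSolutions.sum_mem fun c _ => hh c, fun c hc => ?_⟩
  rw [map_sum]
  exact (h1 c hc).trans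
    (Finset.single_le_sum (f := fun c' => f c (h c')) (fun _ _ => Nat.zero_le _)
      (Finset.mem_univ c))

theorem exists_le_of_iSup_eq_top {X : Type} {S : Set X} {f : X → ℕ}
    (h : (⨆ z ∈ S, (f z : ℕ∞)) = ⊤) (N : ℕ) : ∃ z ∈ S, N ≤ f z := by
  by_contra! hN
  have : (⨆ z ∈ S, (f z : ℕ∞)) ≤ N := iSup₂_le fun z hz => by exact_mod_cast (hN z hz).le
  rw [h, top_le_iff] at this
  exact ENat.natCast_ne_top N this

theorem Perfect.exists_homSolution (hξ : ξ.Perfect) : ∃ h ∈ ξ.homSolutions,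
    (∀ j i, (ξ.M j).sIn i = ⊤ → 1 ≤ (h j).1 i) ∧
    (∀ j i, (ξ.M j).sOut i = ⊤ → 1 ≤ (h j).2.2 i) ∧
    ∀ j e, 1 ≤ (h j).2.1 e := by
  obtain ⟨h₁, hh₁, h₁'⟩ := exists_homSolution_forall_pos (ξ := ξ)
    fun c : Fin (ξ.k + 1) × Fin d =>
      { toFun := fun z => (z c.1).1 c.2, map_zero' := rfl, map_add' := fun _ _ => rfl }
  obtain ⟨h₂, hh₂, h₂'⟩ := exists_homSolution_forall_pos (ξ := ξ)
    fun c : Fin (ξ.k + 1) × Fin d =>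
      { toFun := fun z => (z c.1).2.2 c.2, map_zero' := rfl, map_add' := fun _ _ => rfl }
  obtain ⟨h₃, hh₃, h₃'⟩ := exists_homSolution_forall_pos (ξ := ξ)
    fun c : (j : Fin (ξ.k + 1)) × (ξ.M j).G.E =>
      { toFun := fun z => (z c.1).2.1 c.2, map_zero' := rfl, map_add' := fun _ _ => rfl }
  refine ⟨h₁ + h₂ + h₃, ξ.homSolutions.add_mem (ξ.homSolutions.add_mem hh₁ hh₂) hh₃,
    fun j i hi => ?_, fun j i hi => ?_, fun j e => ?_⟩
  · have h1 : 1 ≤ (h₁ j).1 i := h₁' (j, i) (exists_le_of_iSup_eq_top (by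
      have := congrFun (hξ.2 j).2.2.1 i
      simp only [iSup_apply, hi] at this
      exact this))
    exact h1.trans ((Nat.le_add_right _ _).trans (Nat.le_add_right _ _))
  · have h1 : 1 ≤ (h₂ j).2.2 i := h₂' (j, i) (exists_le_of_iSup_eq_top (by
      have := congrFun (hξ.2 j).2.2.2.1 i
      simp only [iSup_apply, hi] at this
      exact this))
    exact h1.trans ((Nat.le_add_left _ _).trans (Nat.le_add_right _ _))
  · have h1 : 1 ≤ (h₃ j).2.1 e := h₃' ⟨j, e⟩ (exists_le_of_iSup_eq_top ((hξ.2 j).2.2.2.2 e))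
    exact h1.trans (Nat.le_add_left _ _)

end MWGSeq

end Linear

/-! ### The set `ξ.ideal`: lower, directed, and dominated by `ξ.runs` -/

section Ideals

variable {d : ℕ} {A : Finset (Fin d → ℤ)}

theorem mem_downTriple_of_le {e : Triple (PConf d) A} {t t' : Triple (Conf d) A} (h : t' ≤ t)
    (ht : t ∈ downTriple e) : t' ∈ downTriple e :=
  ⟨fun i => (Nat.cast_le.2 (h.1 i)).trans (ht.1 i), h.2.1.trans ht.2.1,
    fun i => (Nat.cast_le.2 (h.2.2 i)).trans (ht.2.2 i)⟩

theorem sup_mem_downConf {u : PConf d} {c c' : Conf d} (hc : c ∈ downConf u)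
    (hc' : c' ∈ downConf u) : c ⊔ c' ∈ downConf u := by
  intro i
  rcases le_total (c i) (c' i) with h | h
  · simpa [emb, h] using hc' i
  · simpa [emb, h] using hc i

/-- Languages that are downward closed for the subword embedding. -/
def IsLowerLanguage {α : Type} [Preorder α] (L : Language α) : Prop :=
  ∀ w ∈ L, ∀ w', List.SublistForall₂ (· ≤ ·) w' w → w' ∈ L

theorem isLowerLanguage_starAtom {α : Type} [Preorder α] {D : Set α} (hD : IsLowerSet D) :
    IsLowerLanguage (starAtom D) := by
  intro w hw w' h
  induction h with
  | nil => exact fun t ht => by simp at ht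
  | cons hab _ ih =>
    intro t ht
    rcases List.mem_cons.1 ht with rfl | ht
    · exact hD hab (hw _ (by simp))
    · exact ih (fun s hs => hw s (by simp [hs])) t ht
  | cons_right _ ih => exact ih fun s hs => hw s (by simp [hs])

theorem isLowerLanguage_optAtom {α : Type} [Preorder α] {D : Set α} (hD : IsLowerSet D) :
    IsLowerLanguage (optAtom D) := by
  rintro w (rfl | ⟨t, ht, rfl⟩) w' h
  · cases h
    exact Or.inl rfl
  · cases h with
    | nil => exact Or.inl rfl
    | cons hab h =>
      cases h
      exact Or.inr ⟨_, hD hab ht, rfl⟩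
    | cons_right h =>
      cases h
      exact Or.inl rfl

/-- An embedding into a concatenation splits at the point where its image passes from the first
factor to the second. -/
theorem IsLowerLanguage.mul {α : Type} [Preorder α] {L M : Language α} (hL : IsLowerLanguage L)
    (hM : IsLowerLanguage M) : IsLowerLanguage (L * M) := by
  intro w hw w' h
  obtain ⟨a, ha, b, hb, rfl⟩ := Language.mem_mul.1 hw
  obtain ⟨l, h1, h2⟩ := List.sublistForall₂_iff.1 h
  obtain ⟨l₁, l₂, rfl, h3, h4⟩ := List.sublist_append_iff.1 h2
  rw [← List.take_append_drop l₁.length w']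
  exact Language.mem_mul.2 ⟨_, hL a ha _ (List.sublistForall₂_iff.2
    ⟨l₁, List.forall₂_take_append _ _ _ h1, h3⟩), _, hM b hb _ (List.sublistForall₂_iff.2
    ⟨l₂, List.forall₂_drop_append _ _ _ h1, h4⟩), rfl⟩

theorem isLowerLanguage_prod {α : Type} [Preorder α] {l : List (Language α)}
    (h : ∀ L ∈ l, IsLowerLanguage L) : IsLowerLanguage l.prod := by
  induction l with
  | nil =>
    intro w hw w' h
    simp only [List.prod_nil, Language.mem_one] at hw ⊢
    subst hw
    cases h
    rfl
  | cons L l ih =>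
    rw [List.prod_cons]
    exact (h L (by simp)).mul (ih fun L' h' => h L' (by simp [h']))

theorem emb_le_of_proj_eq {u : PConf d} {c : Conf d} (h : proj (finCoords u) (emb c) = u) :
    emb c ≤ u := by
  intro i
  by_cases hi : u i = ⊤
  · rw [hi]; exact le_top
  · exact (proj_emb_eq_iff.1 h i hi).ge

/-- The source of the run lies below `M.G.s`, and the cycle with the same label then dominates the
run letter by letter. -/
theorem MarkedWitnessGraph.word_mem_starAtom (M : MarkedWitnessGraph A) {r : Prerun A}
    (hr : r ∈ M.runs) : r.word ∈ starAtom (⋃ e ∈ M.G.E, downTriple e) := by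
  obtain ⟨hr, ⟨w, hw, hp, hl⟩, hin, -⟩ := hr
  have hle : emb r.src ≤ M.G.s := by
    intro i
    by_cases hi : M.G.s i = ⊤
    · rw [hi]; exact le_top
    · rw [← M.sIn_eq hi]; exact emb_le_of_proj_eq hin i
  have h := forall₂_mem_downTriple (fun e he => (M.G.edges e (hw e he)).2.2) hp hr.1 hr.2
    hl.symm hle
  intro t ht
  obtain ⟨n, hn, rfl⟩ := List.mem_iff_getElem.1 ht
  have hn' : n < w.length := h.length_eq ▸ hn
  exact Set.mem_iUnion₂.2 ⟨w[n], hw _ (List.getElem_mem hn'), h.get hn hn'⟩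

theorem isRun_append {u p v : Conf d} {w w' : List (Triple (Conf d) A)}
    (h : IsRun ⟨u, w, p⟩) (h' : IsRun ⟨p, w', v⟩) : IsRun (⟨u, w ++ w', v⟩ : Prerun A) := by
  refine ⟨fun t ht => ?_, isPath_append.2 ⟨p, h.2, h'.2⟩⟩
  rcases List.mem_append.1 ht with ht | ht
  exacts [h.1 t ht, h'.1 t ht]

theorem isRun_flatten {k : ℕ} {r : Fin (k + 1) → Prerun A} {a : Fin k → A}
    (hr : ∀ j, IsRun (r j))
    (ha : ∀ j : Fin k, IsTransition ⟨(r j.castSucc).tgt, a j, (r j.succ).src⟩) :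
    IsRun (⟨(r 0).src, (r 0).word ++ (List.ofFn fun j : Fin k =>
      (⟨(r j.castSucc).tgt, a j, (r j.succ).src⟩ : Triple (Conf d) A) ::
        (r j.succ).word).flatten, (r (Fin.last k)).tgt⟩ : Prerun A) := by
  induction k with
  | zero => simpa using hr 0
  | succ k ih =>
    refine isRun_append (hr 0) ?_
    have h := ih (fun j => hr j.succ) fun j => ha j.succ
    rw [List.ofFn_succ, List.flatten_cons, List.cons_append]
    refine ⟨fun t ht => ?_, rfl, h.2⟩
    rcases List.mem_cons.1 ht with rfl | ht
    exacts [ha 0, h.1 t ht]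

namespace MWGSeq

variable {x y : Conf d} {ξ : MWGSeq A x y}

theorem isLowerSet_ideal : IsLowerSet ξ.ideal := by
  have hg : ∀ j, IsLowerLanguage (ξ.graphAtom j) := fun j =>
    isLowerLanguage_starAtom (isLowerSet_iUnion₂ fun e _ _ _ h ht => mem_downTriple_of_le h ht)
  have ha : ∀ j, IsLowerLanguage (ξ.actionAtom j) := fun j =>
    isLowerLanguage_optAtom fun _ _ h ht => mem_downTriple_of_le h ht
  intro p q h hp
  refine ⟨h.1.trans hp.1, ((hg 0).mul (isLowerLanguage_prod fun L hL => ?_)) _ hp.2.1 _ h.2.1,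
    h.2.2.trans hp.2.2⟩
  obtain ⟨j, rfl⟩ := List.mem_ofFn.1 hL
  exact (ha j).mul (hg j.succ)

theorem mem_word_language_iff {w : List (Triple (Conf d) A)} :
    w ∈ ξ.graphAtom 0 *
        (List.ofFn fun j : Fin ξ.k => ξ.actionAtom j * ξ.graphAtom j.succ).prod ↔
      ∃ (g : Fin (ξ.k + 1) → List (Triple (Conf d) A)) (b : Fin ξ.k → List (Triple (Conf d) A)),
        (∀ j, g j ∈ ξ.graphAtom j) ∧ (∀ j, b j ∈ ξ.actionAtom j) ∧
          w = g 0 ++ (List.ofFn fun j => b j ++ g j.succ).flatten := by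
  simp only [Language.mem_mul, mem_prod_ofFn]
  constructor
  · rintro ⟨u, hu, _, ⟨f, hf, rfl⟩, rfl⟩
    choose b hb g hg hf using hf
    refine ⟨Fin.cons u g, b, Fin.cases hu hg, hb, ?_⟩
    simp [hf]
  · rintro ⟨g, b, hg, hb, rfl⟩
    exact ⟨g 0, hg 0, _, ⟨_, fun j => ⟨b j, hb j, g j.succ, hg j.succ, rfl⟩, rfl⟩, rfl⟩

theorem runs_subset_ideal : ξ.runs ⊆ ξ.ideal := by
  rintro ρ ⟨r, hr, ha, h1, h2, h3⟩
  refine ⟨?_, ?_, ?_⟩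
  · have := emb_le_of_proj_eq (hr 0).2.2.1
    rw [ξ.first, ← h1] at this
    exact fun i => Nat.cast_le.1 (this i)
  · rw [h2, mem_word_language_iff]
    refine ⟨fun j => (r j).word, fun j => [⟨(r j.castSucc).tgt, ξ.a j, (r j.succ).src⟩],
      fun j => (ξ.M j).word_mem_starAtom (hr j), fun j => Or.inr ⟨_, ⟨?_, rfl, ?_⟩, rfl⟩, rfl⟩
    · exact emb_le_of_proj_eq (hr j.castSucc).2.2.2
    · exact emb_le_of_proj_eq (hr j.succ).2.2.1
  · have := emb_le_of_proj_eq (hr (Fin.last _)).2.2.2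
    rw [ξ.last, ← h3] at this
    exact fun i => Nat.cast_le.1 (this i)

theorem eq_of_proj_emb {u c : Conf d} (h : proj (finCoords (emb u)) (emb c) = emb u) :
    c = u := by
  funext i
  exact (Nat.cast_inj.1 (proj_emb_eq_iff.1 h i (ENat.natCast_ne_top _))).symm

theorem runs_subset_Runs : ξ.runs ⊆ Runs A x y := by
  rintro ⟨u, w, v⟩ ⟨r, hr, ha, rfl, rfl, rfl⟩
  exact ⟨isRun_flatten (fun j => (hr j).1) ha, eq_of_proj_emb (by
    have := (hr 0).2.2.1
    rwa [ξ.first] at this), eq_of_proj_emb (by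
    have := (hr (Fin.last _)).2.2.2
    rwa [ξ.last] at this)⟩

/-- All triples below `e` carry the same action, so they have joins; the empty word may be replaced
by any such triple. Used with b = b', it turns an optional letter into an actual one. -/
theorem exists_mem_downTriple_of_optAtom {e : Triple (PConf d) A}
    {b b' : List (Triple (Conf d) A)} (hb : b ∈ optAtom (downTriple e))
    (hb' : b' ∈ optAtom (downTriple e)) :
    ∃ τ ∈ downTriple e, List.SublistForall₂ (· ≤ ·) b [τ] ∧
      List.SublistForall₂ (· ≤ ·) b' [τ] := by
  have hle : ∀ {b : List (Triple (Conf d) A)}, b ∈ optAtom (downTriple e) →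
      ∃ τ ∈ downTriple e, List.SublistForall₂ (· ≤ ·) b [τ] := by
    rintro b (rfl | ⟨τ, hτ, rfl⟩)
    · exact ⟨⟨0, e.act, 0⟩, ⟨fun i => by simp [emb], rfl, fun i => by simp [emb]⟩, .nil⟩
    · exact ⟨τ, hτ, .cons le_rfl .nil⟩
  obtain ⟨τ, hτ, h⟩ := hle hb
  obtain ⟨τ', hτ', h'⟩ := hle hb'
  have up : ∀ {τ σ : Triple (Conf d) A} {b : List (Triple (Conf d) A)},
      List.SublistForall₂ (· ≤ ·) b [τ] → τ ≤ σ → List.SublistForall₂ (· ≤ ·) b [σ] :=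
    fun h hle => trans_of (List.SublistForall₂ (· ≤ ·)) h (.cons hle .nil)
  refine ⟨⟨τ.src ⊔ τ'.src, e.act, τ.tgt ⊔ τ'.tgt⟩, ⟨sup_mem_downConf hτ.1 hτ'.1, rfl,
      sup_mem_downConf hτ.2.2 hτ'.2.2⟩,
    up h ⟨le_sup_left, hτ.2.1, le_sup_left⟩, up h' ⟨le_sup_right, hτ'.2.1, le_sup_right⟩⟩

/-- Star atoms are closed under concatenation and optional atoms have upper bounds, so two
factorizations are merged atom by atom. -/
theorem directedOn_ideal : DirectedOn (· ≤ ·) ξ.ideal := by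
  rintro p ⟨hp₁, hp₂, hp₃⟩ q ⟨hq₁, hq₂, hq₃⟩
  obtain ⟨g, b, hg, hb, hp⟩ := mem_word_language_iff.1 hp₂
  obtain ⟨g', b', hg', hb', hq⟩ := mem_word_language_iff.1 hq₂
  choose τ hτ hbτ hbτ' using fun j => exists_mem_downTriple_of_optAtom (hb j) (hb' j)
  have left : ∀ j, List.SublistForall₂ (· ≤ ·) (g j) (g j ++ g' j) := fun j => by
    simpa using sublistForall₂_append (refl_of (List.SublistForall₂ (· ≤ ·)) (g j))
      (.nil : List.SublistForall₂ (· ≤ ·) [] (g' j))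
  have right : ∀ j, List.SublistForall₂ (· ≤ ·) (g' j) (g j ++ g' j) := fun j => by
    simpa using sublistForall₂_append (.nil : List.SublistForall₂ (· ≤ ·) [] (g j))
      (refl_of (List.SublistForall₂ (· ≤ ·)) (g' j))
  refine ⟨⟨x, (g 0 ++ g' 0) ++ (List.ofFn fun j => [τ j] ++ (g j.succ ++ g' j.succ)).flatten, y⟩,
    ⟨le_rfl, mem_word_language_iff.2 ⟨fun j => g j ++ g' j, fun j => [τ j], fun j t ht => ?_,
      fun j => Or.inr ⟨τ j, hτ j, rfl⟩, rfl⟩, le_rfl⟩, ⟨hp₁, ?_, hp₃⟩, ⟨hq₁, ?_, hq₃⟩⟩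
  · rcases List.mem_append.1 ht with ht | ht
    exacts [hg j t ht, hg' j t ht]
  · rw [hp]
    exact sublistForall₂_append (left 0) (sublistForall₂_flatten_ofFn fun j =>
      sublistForall₂_append (hbτ j) (left j.succ))
  · rw [hq]
    exact sublistForall₂_append (right 0) (sublistForall₂_flatten_ofFn fun j =>
      sublistForall₂_append (hbτ' j) (right j.succ))

theorem nonempty_ideal : ξ.ideal.Nonempty :=
  ⟨⟨x, _, y⟩, le_rfl, mem_word_language_iff.2 ⟨fun _ => [], fun _ => [],
    fun _ _ ht => by simp at ht, fun _ => Or.inl rfl, rfl⟩, le_rfl⟩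

theorem Perfect.exists_run_ge (hξ : ξ.Perfect) {p : Prerun A} (hp : p ∈ ξ.ideal) :
    ∃ ρ ∈ ξ.runs, p ≤ ρ := by
  obtain ⟨z, hz⟩ := hξ.1
  obtain ⟨h, hh, hin, hout, hedge⟩ := hξ.exists_homSolution
  have hz₁ : ∀ j i, (ξ.M j).sIn i ≠ ⊤ → (ξ.M j).sIn i = (z j).1 i :=
    fun j => proj_emb_eq_iff.1 (hz.2.2.2 j).1
  have hz₂ : ∀ j i, (ξ.M j).sOut i ≠ ⊤ → (ξ.M j).sOut i = (z j).2.2 i :=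
    fun j => proj_emb_eq_iff.1 (hz.2.2.2 j).2
  choose N hN using fun j => (ξ.M j).exists_runs (hξ.2 j).1 (hξ.2 j).2.1
    (ξ.isFlow_of_mem_L hz j) (hh.1 j)
    (fun e he => by rw [extendZero_coe (h j).2.1 ⟨e, he⟩]; exact hedge j _) (hz₁ j) (hz₂ j)
    (fun i => (hh.2.2 j i).1) (fun i => (hh.2.2 j i).2) (hin j) (hout j)
  obtain ⟨hp₁, hp₂, hp₃⟩ := hp
  obtain ⟨g, b, hg, hb, hw⟩ := mem_word_language_iff.1 hp₂
  choose τ hτ hbτ _ using fun j => exists_mem_downTriple_of_optAtom (hb j) (hb j)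
  -- One multiplier for all graphs; the extra 1 makes it positive, so that ω-coordinates of the
  -- endpoints grow with t.
  have hm : ∀ j, N j ≤ ∑ j, N j + 1 := fun j =>
    (Finset.single_le_sum (fun _ _ => Nat.zero_le _) (Finset.mem_univ j)).trans (Nat.le_succ _)
  generalize ∑ j, N j = m at hm
  choose T hT using fun j => hN j _ (hm j) (g j) (hg j)
  -- `B` bounds the triples between the graphs; t must exceed it so that the endpoints of the runs
  -- dominate them.
  obtain ⟨B, hB⟩ := exists_bound (List.ofFn τ)
  have ht : ∀ j, T j ≤ ∑ j, T j + B := fun j =>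
    (Finset.single_le_sum (fun _ _ => Nat.zero_le _) (Finset.mem_univ j)).trans
      (Nat.le_add_right _ _)
  have htB : B ≤ ∑ j, T j + B := Nat.le_add_left _ _
  generalize ∑ j, T j + B = t at ht htB
  choose r hr hr₁ hr₂ hr₃ using fun j => hT j t (ht j)
  have large : ∀ {u : PConf d} {c v₀ v₁ v : Conf d}, c ∈ downConf u →
      (∀ i, u i ≠ ⊤ → u i = v₀ i) → (∀ i, u i = ⊤ → 1 ≤ v₁ i) →
      (∀ i, v i = v₀ i + (t + 1) * ((m + 1) * v₁ i)) → (∀ i, c i ≤ B) → c ≤ v := by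
    intro u c v₀ v₁ v hc h₀ h₁ hv hB i
    change c i ≤ v i
    by_cases hi : u i = ⊤
    · have h2 := Nat.mul_le_mul (Nat.le_add_left 1 m) (h₁ i hi)
      have h3 := Nat.mul_le_mul_left (t + 1) h2
      have h4 := hB i
      rw [hv]
      omega
    · have h2 := hc i
      rw [h₀ i hi, emb, Nat.cast_le] at h2
      rw [hv]
      omega
  refine ⟨⟨(r 0).src, (r 0).word ++ (List.ofFn fun j : Fin ξ.k =>
      (⟨(r j.castSucc).tgt, ξ.a j, (r j.succ).src⟩ : Triple (Conf d) A) ::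
        (r j.succ).word).flatten, (r (Fin.last ξ.k)).tgt⟩,
    ⟨r, hr, fun j i => ?_, rfl, rfl, rfl⟩, ?_, ?_, ?_⟩
  -- The solution `z` accounts for the action, while equal multiples of the homogeneous part cancel
  -- on both sides.
  · have h1 := hz.2.2.1 j i
    have h2 := congrFun (hh.2.1 j) i
    simp only [hr₁, hr₂, h2] at h1 ⊢
    push_cast
    linarith
  · have h1 := (hr 0).2.2.1
    rw [ξ.first] at h1
    rw [eq_of_proj_emb h1]
    exact hp₁
  · rw [hw]
    refine sublistForall₂_append (hr₃ 0) (sublistForall₂_flatten_ofFn fun j => ?_)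
    rw [← List.singleton_append]
    refine sublistForall₂_append (trans_of (List.SublistForall₂ (· ≤ ·)) (hbτ j)
      (.cons ⟨?_, (hτ j).2.1, ?_⟩ .nil)) (hr₃ j.succ)
    · exact large (hτ j).1 (hz₂ _) (hout _) (hr₂ _)
        fun i => (hB (τ j) (List.mem_ofFn.2 ⟨j, rfl⟩) i).1
    · exact large (hτ j).2.2 (hz₁ _) (hin _) (hr₁ _)
        fun i => (hB (τ j) (List.mem_ofFn.2 ⟨j, rfl⟩) i).2
  · have h1 := (hr (Fin.last _)).2.2.2
    rw [ξ.last] at h1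
    rw [eq_of_proj_emb h1]
    exact hp₃

end MWGSeq

end Ideals

end VAS

theorem mainTheorem5 (d : ℕ) (A : Finset (Fin d → ℤ)) (x y : VAS.Conf d)
    (ξ : VAS.MWGSeq A x y) (hξ : ξ.Perfect) :
    VAS.InAdherence (VAS.Runs A x y) ξ.ideal ∧
      ξ.ideal = (lowerClosure ξ.runs : Set (VAS.Prerun A)) := by
  have heq : ξ.ideal = (lowerClosure ξ.runs : Set (VAS.Prerun A)) := by
    refine Set.Subset.antisymm (fun p hp => ?_) ?_
    · obtain ⟨ρ, hρ, hle⟩ := hξ.exists_run_ge hp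
      exact ⟨ρ, hρ, hle⟩
    · rintro p ⟨ρ, hρ, hle⟩
      exact VAS.MWGSeq.isLowerSet_ideal hle (VAS.MWGSeq.runs_subset_ideal hρ)
  refine ⟨⟨⟨VAS.MWGSeq.isLowerSet_ideal, VAS.MWGSeq.nonempty_ideal,
    VAS.MWGSeq.directedOn_ideal⟩, ξ.runs, VAS.MWGSeq.runs_subset_Runs, ?_, heq.symm⟩, heq⟩
  -- Directedness passes to `ξ.runs` by cofinality: an upper bound in the ideal lies below a run.
  intro p hp q hq
  obtain ⟨s, hs, hps, hqs⟩ := VAS.MWGSeq.directedOn_ideal p (VAS.MWGSeq.runs_subset_ideal hp) q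
    (VAS.MWGSeq.runs_subset_ideal hq)
  obtain ⟨ρ, hρ, hle⟩ := hξ.exists_run_ge hs
  exact ⟨ρ, hρ, hps.trans hle, hqs.trans hle⟩
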